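/- All functions are real and smooth ($C^\infty$) on open sets. Let $J\subset\mathbb{R}^3$ be open, with coordinates $(t,x,x_1)$, let $M$ be its projection to the $(t,x)$-plane, let $x_2=F(t,x,x_1)$ be a second-order ODE with $F$ smooth on $J$, and let $A=\partial_t+x_1\partial_x+F\partial_{x_1}$. For $i=1,2$ let $H_i=H_i(t,x,x_1)$ be smooth on $J$, let $\Omega_i\subset\mathbb{R}^4$ be an open set of points $(t,x,x_1,w)$ with projection $J$, and let $$\mathbf v_i=\xi_i\,\partial_t+\eta_i\,\partial_x+\psi_i\,\partial_w,\qquad \xi_i,\eta_i,\psi_i\in C^\infty(\Omega_i)\ \text{(functions of } t,x,x_1,w),$$ with $(\xi_i)_w^2+(\eta_i)_w^2\not\equiv 0$. Put $\widetilde A_i=\partial_t+x_1\partial_x+F\partial_{x_1}+H_i\partial_w$ and $\varphi_i=\widetilde A_i(\eta_i)-x_1\widetilde A_i(\xi_i)$. Assume that $\mathbf v_i$ is a nonlocal symmetry of the ODE associated to the covering $x_2=F,\ w_1=H_i$, with a reduction, in the following sense: (a) $\xi_i\partial_t+\eta_i\partial_x+\varphi_i\partial_v+\psi_i\partial_w$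 is a Lie point symmetry of the first-order system $x_1=v,\ v_1=F(t,x,v),\ w_1=H_i(t,x,v)$ (here $v=x_1$); (b) $z^i=z^i(t,x)$ on $M$ and $\zeta^i=\zeta^i(t,x,x_1)$ on $J$ are smooth, with linearly independent differentials at every point of $J$, and $\xi_i z^i_t+\eta_i z^i_x=0$, $\ \xi_i\zeta^i_t+\eta_i\zeta^i_x+\varphi_i\zeta^i_{x_1}=0$ on $\Omega_i$; (c) $D_tz^i=z^i_t+x_1z^i_x$ does not vanish on $J$, and the ODE can be written as a first-order ODE (the reduced equation) $G_i(z^i,\zeta^i,\zeta^i_{z^i})=0$ with $G_i$ smooth: for all $(t,x,x_1)\in J$ and $x_2\in\mathbb{R}$ one has $x_2=F(t,x,x_1)$ if and only if $G_i(z^i,\zeta^i,\zeta^i_{z^i})=0$, where $\zeta^i_{z^i}=(\zeta^i_t+x_1\zeta^i_x+x_2\zeta^i_{x_1})/D_tz^i$. Assume moreover that for each $i$ either $\xi_i$ vanishes nowhere on $\Omega_i$, or $\xi_i\equiv0$ and $\eta_i$ vanishes nowhere on $\Omega_i$. Let $(\mathbf X_i,\lambda_i)$ be the associated pair $$\mathbf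 X_i=\partial_t+\frac{\eta_i}{\xi_i}\partial_x,\quad \lambda_i=\frac{\widetilde A_i(\xi_i)}{\xi_i}\quad(\xi_i\neq0),\qquad\qquad \mathbf X_i=\partial_x,\quad \lambda_i=\frac{\widetilde A_i(\eta_i)}{\eta_i}\quad(\xi_i=0).$$ Then $\mathbf X_i$ is a vector field on $M$, $\lambda_i$ is a function on $J$ (the coefficients $\eta_i/\xi_i$ do not depend on $x_1,w$, and $\lambda_i$ does not depend on $w$), and $(\mathbf X_i,\lambda_i)$ defines a $\lambda$-symmetry of the ODE, i.e. the second-order $\lambda_i$-prolongation of $\mathbf X_i$ is tangent to $\{x_2=F\}$. Moreover, the following are equivalent. 1. The reduced equations are functionally dependent: every point of $J$ has a neighbourhood on which the two reduced equations have smooth first integrals $I_i=I_i(z^i,\zeta^i)$ with nowhere vanishing differential (so $I_z+s\,I_\zeta=0$ whenever $G_i(z,\zeta,s)=0$) such that, as functions of $(t,x,x_1)$, $I_1=g(I_2)$ for some smooth function $g$ of one variable. 2. $(\mathbf X_1,\lambda_1)$ and $(\mathbf X_2,\lambda_2)$ are $A$-equivalent: the characteristics $Q_i=\phi_i-\rho_ix_1$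 of $\mathbf X_i=\rho_i\partial_t+\phi_i\partial_x$ vanish nowhere on $J$, and $$\lambda_1+\frac{A(Q_1)}{Q_1}=\lambda_2+\frac{A(Q_2)}{Q_2}\qquad\text{on } J.$$ -/

import Mathlib

open scoped ContDiff

namespace NonlocalReduction

/-- Points `(t, x)`. -/
abbrev Plane : Type := ℝ × ℝ

/-- Points `(t, x, x₁)` of the first-order jet space. -/
abbrev Jet : Type := ℝ × ℝ × ℝ

/-- Points `(t, x, x₁, w)` of the covering space. With `v = x₁` these are also the points
`(t, x, v, w)` on which the equivalent first-order system lives. -/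
abbrev Cov : Type := ℝ × ℝ × ℝ × ℝ

/-- The projection `(t, x, x₁) ↦ (t, x)`. -/
def base (p : Jet) : Plane := (p.1, p.2.1)

/-- The projection `(t, x, x₁, w) ↦ (t, x, x₁)`. -/
def jet (q : Cov) : Jet := (q.1, q.2.1, q.2.2.1)

/-! ### Total derivatives -/

/-- Total derivative of a function of `(t, x)`: `D_t f = f_t + x₁ f_x`, a function of
`(t, x, x₁)`. -/
noncomputable def totalD₀ (f : Plane → ℝ) (p : Jet) : ℝ :=
  fderiv ℝ f (base p) (1, p.2.2)

/-- Total derivative of a function of `(t, x, x₁)`: `D_t f = f_t + x₁ f_x + x₂ f_{x₁}`, a function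
of `(t, x, x₁)` and `x₂`. -/
noncomputable def totalD₁ (f : Jet → ℝ) (p : Jet) (x₂ : ℝ) : ℝ :=
  fderiv ℝ f p (1, p.2.2, x₂)

/-- The vector field `A = ∂_t + x₁ ∂_x + F ∂_{x₁}` associated to the equation `x₂ = F(t, x, x₁)`,
acting on functions of `(t, x, x₁)`. -/
noncomputable def vfA (F : Jet → ℝ) (f : Jet → ℝ) (p : Jet) : ℝ :=
  totalD₁ f p (F p)

/-- Total derivative of a function of `(t, x, x₁, w)`:
`f_t + x₁ f_x + x₂ f_{x₁} + w₁ f_w`, a function of `(t, x, x₁, w)`, `x₂` and `w₁`. -/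
noncomputable def totalDCov (f : Cov → ℝ) (q : Cov) (x₂ w₁ : ℝ) : ℝ :=
  fderiv ℝ f q (1, q.2.2.1, x₂, w₁)

/-- Restriction of `totalDCov f` to the system `x₂ = F(t, x, x₁)`, `w₁ = H(t, x, x₁)`. -/
noncomputable def totalDOnSystem (F H : Jet → ℝ) (f : Cov → ℝ) (q : Cov) : ℝ :=
  totalDCov f q (F (jet q)) (H (jet q))

/-! ### λ-symmetries of the equation `x₂ = F(t, x, x₁)` -/

/-- A pair `(X, λ)` with `X = ρ(t, x) ∂_t + φ(t, x) ∂_x` and `λ = λ(t, x, x₁)`. -/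
structure LambdaPair where
  ρ : Plane → ℝ
  φ : Plane → ℝ
  lam : Jet → ℝ

namespace LambdaPair

variable (P : LambdaPair)

/-- The characteristic `Q = φ - ρ x₁` of `X`. -/
noncomputable def Q (p : Jet) : ℝ := P.φ (base p) - P.ρ (base p) * p.2.2

/-- The coefficient of `∂_{x₁}` in the λ-prolongation of `X`:
`D_t φ - D_t(ρ) x₁ + λ (φ - ρ x₁)`. -/
noncomputable def φ₁ (p : Jet) : ℝ :=
  totalD₀ P.φ p - totalD₀ P.ρ p * p.2.2 + P.lam p * (P.φ (base p) - P.ρ (base p) * p.2.2)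

/-- The coefficient of `∂_{x₂}` in the λ-prolongation of `X`:
`D_t φ₁ - D_t(ρ) x₂ + λ (φ₁ - ρ x₂)`. -/
noncomputable def φ₂ (p : Jet) (x₂ : ℝ) : ℝ :=
  totalD₁ P.φ₁ p x₂ - totalD₀ P.ρ p * x₂ + P.lam p * (P.φ₁ p - P.ρ (base p) * x₂)

/-- `(X, λ)` defines a λ-symmetry on `J` of `x₂ = F(t, x, x₁)`: its coefficients are smooth, and the
second λ-prolongation of `X` is tangent to the submanifold `x₂ = F(t, x, x₁)`. -/
def IsLambdaSymmetry (F : Jet → ℝ) (J : Set Jet) : Prop :=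
  ContDiffOn ℝ ∞ P.ρ (base '' J) ∧ ContDiffOn ℝ ∞ P.φ (base '' J) ∧ ContDiffOn ℝ ∞ P.lam J ∧
  ∀ p ∈ J, ∀ x₂ : ℝ, x₂ = F p →
    P.φ₂ p x₂ - fderiv ℝ F p (P.ρ (base p), P.φ (base p), P.φ₁ p) = 0

end LambdaPair

/-- `A`-equivalence on `J` of two pairs:
`λ₁ + A(Q₁)/Q₁ = λ₂ + A(Q₂)/Q₂`, where the denominators do not vanish. -/
def AEquivalent (F : Jet → ℝ) (J : Set Jet) (P₁ P₂ : LambdaPair) : Prop :=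
  ∀ p ∈ J, P₁.Q p ≠ 0 ∧ P₂.Q p ≠ 0 ∧
    P₁.lam p + vfA F P₁.Q p / P₁.Q p = P₂.lam p + vfA F P₂.Q p / P₂.Q p

/-! ### Symmetries of coverings -/

/-- A vector field `ξ ∂_t + η ∂_x + ψ ∂_w` whose coefficients depend on `(t, x, x₁, w)`. -/
structure CovField where
  ξ : Cov → ℝ
  η : Cov → ℝ
  ψ : Cov → ℝ

namespace CovField

variable (v : CovField)

/-- The coefficient `η¹ = D_t η - D_t(ξ) x₁` of `∂_{x₁}` in the first prolongation, a function of
`(t, x, x₁, w)`, `x₂` and `w₁`. -/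
noncomputable def η₁ (q : Cov) (x₂ w₁ : ℝ) : ℝ :=
  totalDCov v.η q x₂ w₁ - totalDCov v.ξ q x₂ w₁ * q.2.2.1

/-- The restriction of `η¹` to the system `x₂ = F(t, x, x₁)`, `w₁ = H(t, x, x₁)`. -/
noncomputable def η₁OnSystem (F H : Jet → ℝ) (q : Cov) : ℝ :=
  v.η₁ q (F (jet q)) (H (jet q))

end CovField

/-- In the space with coordinates `(t, x, v, w)` and first-order jets `(x₁, v₁, w₁) = (a, b, c)`,
the coefficient of the first prolongation of a vector field `ξ ∂_t + ⋯` that belongs to a dependent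
variable with coefficient `θ` and first derivative `r`:  `D_t θ - D_t(ξ) r`, where
`D_t = ∂_t + a ∂_x + b ∂_v + c ∂_w`. -/
noncomputable def prolong (ξ θ : Cov → ℝ) (r : ℝ) (q : Cov) (a b c : ℝ) : ℝ :=
  fderiv ℝ θ q (1, a, b, c) - fderiv ℝ ξ q (1, a, b, c) * r

/-- `ξ ∂_t + η ∂_x + φ ∂_v + ψ ∂_w` is a Lie point symmetry on `Ω` of the first-order system
`x₁ = v`, `v₁ = F(t, x, v)`, `w₁ = H(t, x, v)`: its first prolongation annihilates `x₁ - v`,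
`v₁ - F` and `w₁ - H` on the submanifold defined by the system. -/
def IsLiePointSymmetry (F H : Jet → ℝ) (Ω : Set Cov) (ξ η φ ψ : Cov → ℝ) : Prop :=
  ∀ q ∈ Ω, ∀ a b c : ℝ, a = q.2.2.1 → b = F (jet q) → c = H (jet q) →
    prolong ξ η a q a b c - φ q = 0 ∧
    prolong ξ φ b q a b c - fderiv ℝ F (jet q) (ξ q, η q, φ q) = 0 ∧
    prolong ξ ψ c q a b c - fderiv ℝ H (jet q) (ξ q, η q, φ q) = 0

/-- `v = ξ ∂_t + η ∂_x + ψ ∂_w`, smooth on the open set `Ω` lying over `J`, is a generalized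
symmetry of the covering `x₂ = F(t, x, x₁)`, `w₁ = H(t, x, x₁)` (that is, the field with the
additional component `η¹` restricted to the system is a Lie point symmetry of the equivalent
first-order system), and `(ξ_w)² + (η_w)²` is not identically zero. -/
structure IsCoveringSymmetry (F : Jet → ℝ) (J : Set Jet) (H : Jet → ℝ) (Ω : Set Cov)
    (v : CovField) : Prop where
  isOpen : IsOpen Ω
  image_eq : jet '' Ω = J
  smooth_H : ContDiffOn ℝ ∞ H J
  smooth_ξ : ContDiffOn ℝ ∞ v.ξ Ω
  smooth_η : ContDiffOn ℝ ∞ v.η Ω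
  smooth_ψ : ContDiffOn ℝ ∞ v.ψ Ω
  symmetry : IsLiePointSymmetry F H Ω v.ξ v.η (v.η₁OnSystem F H) v.ψ
  depends_on_w : ∃ q ∈ Ω,
    (fderiv ℝ v.ξ q (0, 0, 0, 1)) ^ 2 + (fderiv ℝ v.η q (0, 0, 0, 1)) ^ 2 ≠ 0

/-- The function `ζ_z = D_t ζ / D_t z` of `(t, x, x₁)` and `x₂`. -/
noncomputable def zetaDeriv (z : Plane → ℝ) (ζ : Jet → ℝ) (p : Jet) (x₂ : ℝ) : ℝ :=
  totalD₁ ζ p x₂ / totalD₀ z p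

/-- The map `(t, x, x₁) ↦ (z, ζ)`. -/
def newCoords (z : Plane → ℝ) (ζ : Jet → ℝ) (p : Jet) : ℝ × ℝ := (z (base p), ζ p)

/-- The functions `z = z(t, x)` and `ζ = ζ(t, x, x₁)` are functionally independent, they satisfy
`v(z) = 0` and `v⁽¹⁾(ζ) = 0` on the system, and in terms of `{z, ζ, ζ_z}` the equation
`x₂ = F(t, x, x₁)` is the first-order equation `G(z, ζ, ζ_z) = 0`. -/
structure IsReduction (F : Jet → ℝ) (J : Set Jet) (H : Jet → ℝ) (Ω : Set Cov) (v : CovField)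
    (z : Plane → ℝ) (ζ : Jet → ℝ) (G : ℝ × ℝ → ℝ → ℝ) : Prop where
  smooth_z : ContDiffOn ℝ ∞ z (base '' J)
  smooth_ζ : ContDiffOn ℝ ∞ ζ J
  independent : ∀ p ∈ J,
    LinearIndependent ℝ ![fderiv ℝ (fun p' : Jet => z (base p')) p, fderiv ℝ ζ p]
  invariant_z : ∀ q ∈ Ω, fderiv ℝ z (base (jet q)) (v.ξ q, v.η q) = 0
  invariant_ζ : ∀ q ∈ Ω, fderiv ℝ ζ (jet q) (v.ξ q, v.η q, v.η₁OnSystem F H q) = 0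
  totalD_ne : ∀ p ∈ J, totalD₀ z p ≠ 0
  smooth_G : ContDiffOn ℝ ∞ (fun y : (ℝ × ℝ) × ℝ => G y.1 y.2)
    ((newCoords z ζ '' J) ×ˢ (Set.univ : Set ℝ))
  equation : ∀ p ∈ J, ∀ x₂ : ℝ, x₂ = F p ↔ G (newCoords z ζ p) (zetaDeriv z ζ p x₂) = 0

/-- Case 1: `ξ` does not vanish. -/
def CaseOne (Ω : Set Cov) (v : CovField) : Prop := ∀ q ∈ Ω, v.ξ q ≠ 0

/-- Case 2: `ξ = 0`, and `η` does not vanish. -/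
def CaseTwo (Ω : Set Cov) (v : CovField) : Prop := ∀ q ∈ Ω, v.ξ q = 0 ∧ v.η q ≠ 0

/-- `P = (X, λ)` is the pair associated to `v`:
`X = ∂_t + (η/ξ) ∂_x`, `λ = (ξ_t + x₁ ξ_x + F ξ_{x₁} + H ξ_w)/ξ` in Case 1, and
`X = ∂_x`, `λ = (η_t + x₁ η_x + F η_{x₁} + H η_w)/η` in Case 2. Since the functions of `P`
depend on `(t, x)` and `(t, x, x₁)` only, this includes that the right-hand sides do so. -/
def IsAssociatedPair (F H : Jet → ℝ) (Ω : Set Cov) (v : CovField) (P : LambdaPair) : Prop :=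
  (CaseOne Ω v ∧ ∀ q ∈ Ω,
    P.ρ (base (jet q)) = 1 ∧ P.φ (base (jet q)) = v.η q / v.ξ q ∧
    P.lam (jet q) = totalDOnSystem F H v.ξ q / v.ξ q) ∨
  (CaseTwo Ω v ∧ ∀ q ∈ Ω,
    P.ρ (base (jet q)) = 0 ∧ P.φ (base (jet q)) = 1 ∧
    P.lam (jet q) = totalDOnSystem F H v.η q / v.η q)

/-! ### Functional dependence of reduced equations -/

/-- `I = I(z, ζ)` is a (smooth, nondegenerate) first integral on the open set `V` of the
first-order equation `G(z, ζ, ζ_z) = 0`: its differential does not vanish, and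
`D_z I = I_z + ζ_z I_ζ` vanishes by virtue of the equation. -/
def IsFirstIntegral (G : ℝ × ℝ → ℝ → ℝ) (V : Set (ℝ × ℝ)) (I : ℝ × ℝ → ℝ) : Prop :=
  IsOpen V ∧ ContDiffOn ℝ ∞ I V ∧ ∀ y ∈ V, fderiv ℝ I y ≠ 0 ∧
    ∀ s : ℝ, G y s = 0 → fderiv ℝ I y (1, 0) + s * fderiv ℝ I y (0, 1) = 0

/-- The reduced equations `G₁(z¹, ζ¹, ζ¹_{z¹}) = 0` and `G₂(z², ζ², ζ²_{z²}) = 0` are functionally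
dependent on `J`: near every point of `J` they have first integrals `I₁`, `I₂` that, as functions of
`(t, x, x₁)`, satisfy a relation `I₁ = g(I₂)`. -/
def FunctionallyDependent (J : Set Jet)
    (z₁ : Plane → ℝ) (ζ₁ : Jet → ℝ) (G₁ : ℝ × ℝ → ℝ → ℝ)
    (z₂ : Plane → ℝ) (ζ₂ : Jet → ℝ) (G₂ : ℝ × ℝ → ℝ → ℝ) : Prop :=
  ∀ p ∈ J, ∃ U : Set Jet, IsOpen U ∧ p ∈ U ∧ U ⊆ J ∧
    ∃ (V₁ V₂ : Set (ℝ × ℝ)) (I₁ I₂ : ℝ × ℝ → ℝ),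
      IsFirstIntegral G₁ V₁ I₁ ∧ IsFirstIntegral G₂ V₂ I₂ ∧
      ∃ (S : Set ℝ) (g : ℝ → ℝ), IsOpen S ∧ ContDiffOn ℝ ∞ g S ∧
        ∀ p' ∈ U, newCoords z₁ ζ₁ p' ∈ V₁ ∧ newCoords z₂ ζ₂ p' ∈ V₂ ∧
          I₂ (newCoords z₂ ζ₂ p') ∈ S ∧
          I₁ (newCoords z₁ ζ₁ p') = g (I₂ (newCoords z₂ ζ₂ p'))

end NonlocalReduction

open NonlocalReduction

/-!
Throughout, `A = ∂_t + x₁ ∂_x + F ∂_{x₁}`, and `Y = ρ ∂_t + φ ∂_x + φ₁ ∂_{x₁}` is the first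
λ-prolongation of `X = ρ ∂_t + φ ∂_x`.

*The associated pair.* Invariance of `z = z(t, x)` under `v`, together with `D_t z ≠ 0`,
determines the direction of `(ξ, η)` as a function of `(t, x)`, so that `(ξ, η) = g • (ρ, φ)` for
a nowhere vanishing function `g` on the covering space (`g = ξ` or `g = η`). Then `η¹ = g φ₁` for
`λ = D_t g / g`. Since `D_t z ≠ 0`, also `Q ≠ 0`, and independence of `dz` and `dζ` forces
`ζ_{x₁} ≠ 0`, so invariance of `ζ`, that is `Y ζ = 0`, can be solved for `λ`; hence `λ` is a smooth function of `(t, x, x₁)`.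
Dividing the `v`-component of the symmetry condition for the first-order system by `g` gives
exactly the tangency condition for the second λ-prolongation
(`exists_lambdaSymmetry_of_common_factor`).

*The equivalence.* One has `Y = ρ A + Q (∂_x + κ ∂_{x₁})` with `κ = λ + A(Q)/Q`
(`prolongation_eq`), so two pairs are `A`-equivalent exactly when `A` and `Y` span the same plane
field. Differentials of first integrals of a reduced equation, pulled back by `(z, ζ)`, are
nonzero and annihilate `A` and `Y` (`IsFirstIntegral.fderiv_comp_newCoords`), and a nonzero
covector in dimension three determines the plane it annihilates; this shows that functional
dependence implies `A`-equivalence. Conversely, a first integral of the first reduced equation is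
annihilated by `A`, by `Y₁`, and by `A`-equivalence by `Y₂`. As `Y₂` spans the fibres of `(z²,
ζ²)`, it is locally a function of these (`exists_factorization`), and as such a first integral of
the second reduced equation.

*Existence of first integrals.* The reduced equation can be solved for the derivative, and a
smooth scalar equation `ζ' = Φ(z, ζ)` has local smooth first integrals because its local flow is
smooth (`exists_first_integral`). Smooth dependence on initial values (`exists_smooth_local_flow`)
is obtained from the inverse function theorem in a Banach space of curves, where the integral
equation is smooth because superposition operators with smooth symbol are smooth
(`contDiff_superposition`).
-/

namespace NonlocalReduction

/-! ### Superposition operators on spaces of continuous functions -/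

section Superposition

variable {K : Type*} [TopologicalSpace K] [CompactSpace K]

universe u

variable {V W : Type u} [NormedAddCommGroup V] [NormedSpace ℝ V]
  [NormedAddCommGroup W] [NormedSpace ℝ W]

/-- Pointwise application of a continuous family of operators to a continuous family of vectors,
as a bounded bilinear map. -/
noncomputable def pointwiseApply (K : Type*) [TopologicalSpace K] [CompactSpace K]
    (V W : Type u) [NormedAddCommGroup V] [NormedSpace ℝ V]
    [NormedAddCommGroup W] [NormedSpace ℝ W] :
    C(K, V →L[ℝ] W) →L[ℝ] C(K, V) →L[ℝ] C(K, W) :=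
  LinearMap.mkContinuous₂
    (LinearMap.mk₂ ℝ (fun (T : C(K, V →L[ℝ] W)) (h : C(K, V)) =>
        (⟨fun s => T s (h s), T.continuous.clm_apply h.continuous⟩ : C(K, W)))
      (fun _ _ _ => by ext; simp) (fun _ _ _ => by ext; simp)
      (fun _ _ _ => by ext; simp) (fun _ _ _ => by ext; simp)) 1
    (fun T h => by
      refine (ContinuousMap.norm_le _ (by positivity)).2 fun s => ?_
      rw [one_mul]
      exact (T s).le_of_opNorm_le_of_le (T.norm_coe_le_norm s) (h.norm_coe_le_norm s))

/-- The superposition operator `u ↦ f ∘ u` of a `C¹` map `f` is differentiable, its derivative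
being pointwise application of `f' ∘ u`. -/
theorem hasFDerivAt_superposition {f : C(V, W)} {f' : C(V, V →L[ℝ] W)}
    (hf : ∀ x, HasFDerivAt f (f' x) x) (u : C(K, V)) :
    HasFDerivAt (fun v : C(K, V) => f.comp v) (pointwiseApply K V W (f'.comp u)) u := by
  rw [hasFDerivAt_iff_isLittleO_nhds_zero, Asymptotics.isLittleO_iff]
  intro ε hε
  have hcont : ContinuousAt (fun v : C(K, V) => f'.comp v) u :=
    (ContinuousMap.continuous_postcomp f').continuousAt
  obtain ⟨δ, hδ, H⟩ := (Metric.continuousAt_iff (f := fun v : C(K, V) => f'.comp v) (a := u)).1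
    hcont ε hε
  filter_upwards [Metric.ball_mem_nhds (0 : C(K, V)) hδ] with h hh
  rw [mem_ball_zero_iff] at hh
  refine (ContinuousMap.norm_le _ (by positivity)).2 fun s => ?_
  -- A point of the ball around `u s` is the value at `s` of a translate of `u`, so that continuity
  -- of the superposition operator of `f'` bounds the variation of `f'` on this ball.
  have key : ∀ y ∈ Metric.ball (u s) δ, ‖f' y - f' (u s)‖ ≤ ε := by
    intro y hy
    have hd : dist (u + ContinuousMap.const K (y - u s)) u < δ := by
      rw [dist_eq_norm, add_sub_cancel_left, ContinuousMap.norm_lt_iff _ hδ]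
      intro r
      simpa [dist_eq_norm] using hy
    have h2 := ((f'.comp (u + ContinuousMap.const K (y - u s))).dist_apply_le_dist
      (g := f'.comp u) s).trans (H hd).le
    simpa [dist_eq_norm] using h2
  have hmem : u s + h s ∈ Metric.ball (u s) δ := by
    simpa [dist_eq_norm] using (h.norm_coe_le_norm s).trans_lt hh
  have := (convex_ball (u s) δ).norm_image_sub_le_of_norm_hasFDerivWithin_le'
    (fun x _ => (hf x).hasFDerivWithinAt) key (Metric.mem_ball_self hδ) hmem
  rw [add_sub_cancel_left] at this
  exact this.trans (mul_le_mul_of_nonneg_left (h.norm_coe_le_norm s) hε.le)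

/-- Induction on the order: the derivative of a superposition operator is again built from a
superposition operator. -/
theorem contDiff_superposition_nat (n : ℕ) : ∀ {W : Type u} [NormedAddCommGroup W]
    [NormedSpace ℝ W] (f : C(V, W)), ContDiff ℝ ∞ f →
      ContDiff ℝ n (fun v : C(K, V) => f.comp v) := by
  induction n with
  | zero =>
    intro W _ _ f _
    exact contDiff_zero.2 (ContinuousMap.continuous_postcomp f)
  | succ n ih =>
    intro W _ _ f hf
    obtain ⟨hd, hd'⟩ := contDiff_infty_iff_fderiv.1 hf
    refine contDiff_succ_iff_hasFDerivAt.2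
      ⟨fun u => pointwiseApply K V W ((⟨fderiv ℝ f, hd'.continuous⟩ : C(V, V →L[ℝ] W)).comp u),
        ?_, fun u => hasFDerivAt_superposition (fun x => (hd x).hasFDerivAt) u⟩
    exact (pointwiseApply K V W).contDiff.comp (ih ⟨fderiv ℝ f, hd'.continuous⟩ hd')

theorem contDiff_superposition {f : C(V, W)} (hf : ContDiff ℝ ∞ f) :
    ContDiff ℝ ∞ (fun v : C(K, V) => f.comp v) :=
  contDiff_infty.2 fun n => contDiff_superposition_nat n f hf

end Superposition

/-! ### The inverse function theorem -/

/-- A smooth map with invertible derivative at a point restricts to a diffeomorphism of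
neighbourhoods. In contrast to `ContDiffAt.to_localInverse`, the inverse is smooth on a whole
neighbourhood, which does not follow from smoothness of infinite order at a point. -/
theorem exists_smooth_openPartialHomeomorph {E F : Type*} [NormedAddCommGroup E] [NormedSpace ℝ E]
    [NormedAddCommGroup F] [NormedSpace ℝ F] [CompleteSpace E] {f : E → F} {U : Set E}
    (hU : IsOpen U) (hf : ContDiffOn ℝ ∞ f U) {a : E} (ha : a ∈ U) {f' : E ≃L[ℝ] F}
    (hf' : HasFDerivAt f (f' : E →L[ℝ] F) a) :
    ∃ e : OpenPartialHomeomorph E F, (∀ x, e x = f x) ∧ a ∈ e.source ∧ e.source ⊆ U ∧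
      ContDiffOn ℝ ∞ e.symm e.target := by
  have hfa : ContDiffAt ℝ ∞ f a := hf.contDiffAt (hU.mem_nhds ha)
  have hS : IsOpen (U ∩ fderiv ℝ f ⁻¹'
      Set.range (ContinuousLinearEquiv.toContinuousLinearMap : (E ≃L[ℝ] F) → (E →L[ℝ] F))) :=
    (hf.continuousOn_fderiv_of_isOpen hU (by simp)).isOpen_inter_preimage hU
      ContinuousLinearEquiv.isOpen
  let e := (hfa.toOpenPartialHomeomorph f hf' (by simp)).restrOpen _ hS
  have hsrc : ∀ x ∈ e.source, x ∈ U ∩ fderiv ℝ f ⁻¹'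
      Set.range (ContinuousLinearEquiv.toContinuousLinearMap : (E ≃L[ℝ] F) → (E →L[ℝ] F)) :=
    fun x hx => hx.2
  refine ⟨e, fun x => rfl, ⟨hfa.mem_toOpenPartialHomeomorph_source hf' (by simp), ha, f',
    hf'.fderiv.symm⟩, fun x hx => (hsrc x hx).1, fun y hy => ?_⟩
  obtain ⟨h1, g, hg⟩ := hsrc _ (e.map_target hy)
  have hy' : ContDiffAt ℝ ∞ f (e.symm y) := hf.contDiffAt (hU.mem_nhds h1)
  refine (e.contDiffAt_symm (f₀' := g) hy ?_ hy').contDiffWithinAt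
  rw [hg]
  exact (hy'.differentiableAt (by simp)).hasFDerivAt

/-! ### Smooth local flows -/

section Flow

variable {V : Type*} [NormedAddCommGroup V]

/-- Extension of a continuous curve on `[-1, 1]` to the real line, constant outside. -/
noncomputable def extendCurve (u : C(Set.Icc (-1 : ℝ) 1, V)) (r : ℝ) : V :=
  u (Set.projIcc (-1) 1 (neg_le_self zero_le_one) r)

theorem continuous_extendCurve (u : C(Set.Icc (-1 : ℝ) 1, V)) : Continuous (extendCurve u) :=
  u.continuous.comp continuous_projIcc

theorem extendCurve_coe (u : C(Set.Icc (-1 : ℝ) 1, V)) (r : Set.Icc (-1 : ℝ) 1) :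
    extendCurve u r = u r := by
  simp [extendCurve]

variable [NormedSpace ℝ V]

/-- The integration operator `u ↦ (s ↦ ∫₀ˢ u)` on continuous curves on `[-1, 1]`. -/
noncomputable def primitiveCLM (V : Type*) [NormedAddCommGroup V] [NormedSpace ℝ V] :
    C(Set.Icc (-1 : ℝ) 1, V) →L[ℝ] C(Set.Icc (-1 : ℝ) 1, V) :=
  LinearMap.mkContinuous
    { toFun := fun u => ⟨fun s => ∫ r in (0 : ℝ)..s, extendCurve u r,
        (intervalIntegral.continuous_primitive
          (fun a b => (continuous_extendCurve u).intervalIntegrable a b) 0).comp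
          continuous_subtype_val⟩
      map_add' := fun u v => by
        ext s
        exact intervalIntegral.integral_add ((continuous_extendCurve u).intervalIntegrable _ _)
          ((continuous_extendCurve v).intervalIntegrable _ _)
      map_smul' := fun c u => by
        ext s
        exact intervalIntegral.integral_smul c (extendCurve u) } 1
    (fun u => by
      rw [one_mul]
      refine (ContinuousMap.norm_le _ (norm_nonneg u)).2 fun s => ?_
      refine (intervalIntegral.norm_integral_le_of_norm_le_const
        (fun r _ => u.norm_coe_le_norm _)).trans ?_
      refine mul_le_of_le_one_right (norm_nonneg u) ?_
      rw [sub_zero]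
      exact abs_le.2 s.2)

theorem primitiveCLM_apply (u : C(Set.Icc (-1 : ℝ) 1, V)) (s : Set.Icc (-1 : ℝ) 1) :
    primitiveCLM V u s = ∫ r in (0 : ℝ)..s, extendCurve u r := rfl

/-- Multiplication by `s` as a self-map of `[-1, 1]`. -/
def scaleIcc (s : Set.Icc (-1 : ℝ) 1) : C(Set.Icc (-1 : ℝ) 1, Set.Icc (-1 : ℝ) 1) where
  toFun r := ⟨s * r, abs_le.1 (by
    rw [abs_mul]; exact mul_le_one₀ (abs_le.2 s.2) (abs_nonneg _) (abs_le.2 r.2))⟩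
  continuous_toFun := by fun_prop

theorem smul_primitiveCLM_comp_scaleIcc (u : C(Set.Icc (-1 : ℝ) 1, V))
    (s : Set.Icc (-1 : ℝ) 1) :
    (s : ℝ) • primitiveCLM V (u.comp (scaleIcc s)) = (primitiveCLM V u).comp (scaleIcc s) := by
  ext r
  have h1 : ∀ t ∈ Set.uIcc (0 : ℝ) r,
      extendCurve (u.comp (scaleIcc s)) t = extendCurve u (s * t) := by
    intro t ht
    have htm : t ∈ Set.Icc (-1 : ℝ) 1 :=
      Set.uIcc_subset_Icc (by constructor <;> norm_num) r.2 ht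
    have e1 := extendCurve_coe (u.comp (scaleIcc s)) ⟨t, htm⟩
    have e2 := extendCurve_coe u (scaleIcc s ⟨t, htm⟩)
    exact e1.trans e2.symm
  simp only [ContinuousMap.coe_smul, Pi.smul_apply, ContinuousMap.comp_apply, primitiveCLM_apply]
  rw [intervalIntegral.integral_congr h1, intervalIntegral.smul_integral_comp_mul_left]
  simp [scaleIcc]

variable [CompleteSpace V]

/-- A smooth vector field has a local flow which is smooth jointly in time and initial value.

The curve `s ↦ φ(sτ, x)`, `s ∈ [-1, 1]`, is the solution of the integral equation
`u = x + τ ∫₀ X(u)` in a Banach space of curves, hence depends smoothly on `(τ, x)` by the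
inverse function theorem. Evaluation at `s = 1` is linear, so `φ` is jointly smooth. -/
theorem exists_smooth_local_flow {X : V → V} (hX : ContDiff ℝ ∞ X) (x₀ : V) :
    ∃ (φ : ℝ × V → V) (W : Set (ℝ × V)), IsOpen W ∧ (0, x₀) ∈ W ∧ ContDiffOn ℝ ∞ φ W ∧
      (∀ x, (0, x) ∈ W → φ (0, x) = x) ∧
      ∀ q ∈ W, HasDerivAt (fun t => φ (t, q.2)) (X (φ q)) q.1 := by
  let Xc : C(V, V) := ⟨X, hX.continuous⟩
  let cst : V →L[ℝ] C(Set.Icc (-1 : ℝ) 1, V) := ContinuousLinearMap.const ℝ (Set.Icc (-1 : ℝ) 1)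
  let N : C(Set.Icc (-1 : ℝ) 1, V) → C(Set.Icc (-1 : ℝ) 1, V) :=
    fun u => primitiveCLM V (Xc.comp u)
  have hN : ContDiff ℝ ∞ N := (primitiveCLM V).contDiff.comp (contDiff_superposition hX)
  let f : (ℝ × V) × C(Set.Icc (-1 : ℝ) 1, V) → (ℝ × V) × C(Set.Icc (-1 : ℝ) 1, V) :=
    fun a => (a.1, a.2 - cst a.1.2 - a.1.1 • N a.2)
  have hf : ContDiff ℝ ∞ f := by
    have h1 : ContDiff ℝ ∞ fun a : (ℝ × V) × C(Set.Icc (-1 : ℝ) 1, V) => cst a.1.2 :=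
      cst.contDiff.comp (contDiff_snd.comp contDiff_fst)
    have h2 : ContDiff ℝ ∞ fun a : (ℝ × V) × C(Set.Icc (-1 : ℝ) 1, V) => a.1.1 • N a.2 :=
      (contDiff_fst.comp contDiff_fst).smul (hN.comp contDiff_snd)
    exact contDiff_fst.prodMk ((contDiff_snd.sub h1).sub h2)
  let a₀ : (ℝ × V) × C(Set.Icc (-1 : ℝ) 1, V) := ((0, x₀), cst x₀)
  let ℓ : (ℝ × V) →L[ℝ] C(Set.Icc (-1 : ℝ) 1, V) :=
    -(cst.comp (ContinuousLinearMap.snd ℝ ℝ V)) -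
      (ContinuousLinearMap.fst ℝ ℝ V).smulRight (N (cst x₀))
  let f' : ((ℝ × V) × C(Set.Icc (-1 : ℝ) 1, V)) ≃L[ℝ] (ℝ × V) × C(Set.Icc (-1 : ℝ) 1, V) :=
    (ContinuousLinearEquiv.refl ℝ _).skewProd (ContinuousLinearEquiv.refl ℝ _) ℓ
  have hf' : HasFDerivAt f (f' : _ →L[ℝ] _) a₀ := by
    have h1 : HasFDerivAt (fun a : (ℝ × V) × C(Set.Icc (-1 : ℝ) 1, V) => a.1.1 • N a.2) _ a₀ :=
      (((ContinuousLinearMap.fst ℝ ℝ V).comp (ContinuousLinearMap.fst ℝ _ _)).hasFDerivAt).smul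
        (((hN.differentiable (by simp)) a₀.2).hasFDerivAt.comp a₀ hasFDerivAt_snd)
    have h2 := ((ContinuousLinearMap.fst ℝ (ℝ × V) C(Set.Icc (-1 : ℝ) 1, V)).hasFDerivAt
      (x := a₀)).prodMk ((((ContinuousLinearMap.snd ℝ (ℝ × V)
        C(Set.Icc (-1 : ℝ) 1, V)).hasFDerivAt (x := a₀)).sub
        ((cst.comp ((ContinuousLinearMap.snd ℝ ℝ V).comp
          (ContinuousLinearMap.fst ℝ _ _))).hasFDerivAt (x := a₀))).sub h1)
    refine h2.congr_fderiv ?_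
    ext a <;> simp [f', ℓ, a₀]
  obtain ⟨e, hef, ha₀, -, hes⟩ :=
    exists_smooth_openPartialHomeomorph isOpen_univ hf.contDiffOn (Set.mem_univ a₀) hf'
  obtain ⟨ε, hε, hball⟩ := Metric.isOpen_iff.1 e.open_source a₀ ha₀
  -- `q ∈ W` when the integral equation with parameters `q` has a solution close to the constant.
  let W : Set (ℝ × V) := (fun q => ((q, 0) : (ℝ × V) × C(Set.Icc (-1 : ℝ) 1, V))) ⁻¹'
    (e.target ∩ e.symm ⁻¹' Metric.ball a₀ ε)
  let sol : ℝ × V → C(Set.Icc (-1 : ℝ) 1, V) := fun q => (e.symm (q, 0)).2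
  have hW : IsOpen W :=
    (e.isOpen_inter_preimage_symm Metric.isOpen_ball).preimage (by fun_prop)
  have uniq : ∀ (q : ℝ × V) (u : C(Set.Icc (-1 : ℝ) 1, V)), (q, u) ∈ Metric.ball a₀ ε →
      u = cst q.2 + q.1 • N u → q ∈ W ∧ sol q = u := by
    intro q u hq hu
    have h1 : e (q, u) = (q, 0) := by
      rw [hef]
      refine Prod.ext rfl ?_
      change u - cst q.2 - q.1 • N u = 0
      rw [sub_sub, sub_eq_zero]
      exact hu
    have h2 : e.symm (q, 0) = (q, u) := by rw [← h1, e.left_inv (hball hq)]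
    refine ⟨⟨?_, ?_⟩, ?_⟩
    · change (q, 0) ∈ e.target
      rw [← h1]
      exact e.map_source (hball hq)
    · change e.symm (q, 0) ∈ Metric.ball a₀ ε
      rw [h2]
      exact hq
    · change (e.symm (q, 0)).2 = u
      rw [h2]
  have exist : ∀ q ∈ W, (q, sol q) ∈ Metric.ball a₀ ε ∧ sol q = cst q.2 + q.1 • N (sol q) := by
    intro q hq
    have h1 : f (e.symm (q, 0)) = (q, 0) := by rw [← hef, e.right_inv hq.1]
    have h2 : (e.symm (q, 0)).1 = q := congrArg Prod.fst h1
    have h3 : e.symm (q, 0) = (q, sol q) := Prod.ext h2 rfl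
    have h4 := congrArg Prod.snd h1
    rw [h3] at h4
    refine ⟨h3 ▸ hq.2, ?_⟩
    change sol q - cst q.2 - q.1 • N (sol q) = 0 at h4
    rw [sub_sub, sub_eq_zero] at h4
    exact h4
  have hend : (1 : ℝ) ∈ Set.Icc (-1 : ℝ) 1 := by constructor <;> norm_num
  have hcst : ∀ (x : V) (s : Set.Icc (-1 : ℝ) 1), cst x s = x := fun _ _ => rfl
  -- A rescaled solution solves the rescaled equation, and uniqueness identifies it.
  have rescale : ∀ q ∈ W, ∀ s : Set.Icc (-1 : ℝ) 1,
      ((s : ℝ) * q.1, q.2) ∈ W ∧ sol ((s : ℝ) * q.1, q.2) ⟨1, hend⟩ = sol q s := by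
    intro q hq s
    obtain ⟨h1, h2⟩ := exist q hq
    have h3 : (((s : ℝ) * q.1, q.2), (sol q).comp (scaleIcc s)) ∈ Metric.ball a₀ ε := by
      simp only [Metric.mem_ball, Prod.dist_eq, a₀, max_lt_iff, dist_zero_right] at h1 ⊢
      refine ⟨⟨lt_of_le_of_lt ?_ h1.1.1, h1.1.2⟩, lt_of_le_of_lt ?_ h1.2⟩
      · rw [norm_mul]
        exact mul_le_of_le_one_left (norm_nonneg _) (abs_le.2 s.2)
      · refine (ContinuousMap.dist_le dist_nonneg).2 fun r => ?_
        exact ContinuousMap.dist_apply_le_dist (f := sol q) (g := cst x₀) (scaleIcc s r)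
    obtain ⟨h4, h5⟩ := uniq _ _ h3 (by
      have : N ((sol q).comp (scaleIcc s)) = primitiveCLM V ((Xc.comp (sol q)).comp (scaleIcc s)) :=
        rfl
      rw [mul_comm, mul_smul, this, smul_primitiveCLM_comp_scaleIcc]
      ext r
      exact congrArg (fun v : C(Set.Icc (-1 : ℝ) 1, V) => v (scaleIcc s r)) h2)
    refine ⟨h4, ?_⟩
    rw [h5]
    simp [scaleIcc]
  refine ⟨fun q => sol q ⟨1, hend⟩, W, hW, ?_, ?_, ?_, ?_⟩
  · refine (uniq (0, x₀) (cst x₀) (Metric.mem_ball_self hε) ?_).1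
    simp
  · have h1 : ContDiffOn ℝ ∞ sol W := by
      have : ContDiffOn ℝ ∞ (fun q : ℝ × V =>
          e.symm ((q, 0) : (ℝ × V) × C(Set.Icc (-1 : ℝ) 1, V))) W :=
        hes.comp (by fun_prop) (fun q hq => hq.1)
      exact contDiff_snd.comp_contDiffOn this
    exact (ContinuousMap.evalCLM ℝ (⟨1, hend⟩ : Set.Icc (-1 : ℝ) 1)).contDiff.comp_contDiffOn h1
  · intro x hx
    have := (exist _ hx).2
    change sol (0, x) ⟨1, hend⟩ = x
    rw [this]
    simp [hcst]
  · rintro ⟨τ, x⟩ hq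
    -- The derivative at time `τ` is read off from a solution that reaches beyond `τ`.
    obtain ⟨δ, hδW, hδ⟩ : ∃ δ : ℝ, (δ, x) ∈ W ∧ |τ| < |δ| := by
      have hc : Continuous fun δ : ℝ => (δ, x) := by fun_prop
      obtain ⟨η, hη, hηW⟩ := Metric.isOpen_iff.1 (hW.preimage hc) τ hq
      rcases le_total 0 τ with h | h
      · refine ⟨τ + η / 2, hηW ?_, ?_⟩
        · simp [abs_of_pos hη, hη]
        · rw [abs_of_nonneg h, abs_of_nonneg (by positivity)]
          linarith
      · refine ⟨τ - η / 2, hηW ?_, ?_⟩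
        · simp [abs_of_pos hη, hη]
        · rw [abs_of_nonpos h, abs_of_nonpos (by linarith)]
          linarith
    have hδ0 : δ ≠ 0 := by
      rintro rfl
      simp only [abs_zero] at hδ
      exact absurd (abs_nonneg τ) (not_le.2 hδ)
    have hmem : ∀ t : ℝ, |t| < |δ| → t / δ ∈ Set.Icc (-1 : ℝ) 1 := fun t ht => by
      rw [Set.mem_Icc, ← abs_le, abs_div]
      exact (div_le_one (abs_pos.2 hδ0)).2 ht.le
    have hval : ∀ t : ℝ, ∀ ht : |t| < |δ|,
        sol (t, x) ⟨1, hend⟩ = sol (δ, x) ⟨t / δ, hmem t ht⟩ := by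
      intro t ht
      have := (rescale _ hδW ⟨t / δ, hmem t ht⟩).2
      simpa [div_mul_cancel₀ t hδ0] using this
    have hev : (fun t => sol (t, x) ⟨1, hend⟩) =ᶠ[nhds τ]
        fun t => x + δ • ∫ r in (0 : ℝ)..(t / δ), extendCurve (Xc.comp (sol (δ, x))) r := by
      have : {t : ℝ | |t| < |δ|} ∈ nhds τ :=
        (isOpen_lt continuous_abs continuous_const).mem_nhds hδ
      filter_upwards [this] with t ht
      rw [hval t ht, congrArg (fun v : C(Set.Icc (-1 : ℝ) 1, V) => v ⟨t / δ, hmem t ht⟩)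
        (exist _ hδW).2]
      rfl
    have hcont := continuous_extendCurve (Xc.comp (sol (δ, x)))
    have hprim : HasDerivAt
        (fun s => ∫ r in (0 : ℝ)..s, extendCurve (Xc.comp (sol (δ, x))) r)
        (extendCurve (Xc.comp (sol (δ, x))) (τ / δ)) (τ / δ) :=
      intervalIntegral.integral_hasDerivAt_right (hcont.intervalIntegrable _ _)
        hcont.stronglyMeasurable.stronglyMeasurableAtFilter hcont.continuousAt
    have hlin : HasDerivAt (fun t : ℝ => t / δ) (1 / δ) τ := (hasDerivAt_id τ).div_const δ
    have hder := ((hprim.scomp τ hlin).const_smul δ).const_add x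
    refine (hder.congr_of_eventuallyEq hev).congr_deriv ?_
    rw [smul_smul, mul_one_div_cancel hδ0, one_smul]
    have e1 := extendCurve_coe (Xc.comp (sol (δ, x))) ⟨τ / δ, hmem τ hδ⟩
    change _ = X (sol (τ, x) ⟨1, hend⟩)
    rw [e1, hval τ hδ]
    rfl

end Flow

/-! ### First integrals of first-order equations -/

/-- A smooth first-order equation `ζ' = Φ(z, ζ)` has, near every point, a smooth first integral with
nowhere vanishing differential: the value at a fixed `z` of the solution through the point. -/
theorem exists_first_integral {Φ : ℝ × ℝ → ℝ} {U : Set (ℝ × ℝ)} (hU : IsOpen U)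
    (hΦ : ContDiffOn ℝ ∞ Φ U) {y₀ : ℝ × ℝ} (hy₀ : y₀ ∈ U) :
    ∃ (V : Set (ℝ × ℝ)) (I : ℝ × ℝ → ℝ), IsOpen V ∧ y₀ ∈ V ∧ V ⊆ U ∧ ContDiffOn ℝ ∞ I V ∧
      ∀ y ∈ V, fderiv ℝ I y ≠ 0 ∧ fderiv ℝ I y (1, 0) + Φ y * fderiv ℝ I y (0, 1) = 0 := by
  obtain ⟨r, hr, hrU⟩ := Metric.isOpen_iff.1 hU y₀ hy₀
  let χ : ContDiffBump y₀ := ⟨r / 3, r / 2, by positivity, by linarith⟩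
  have hballU : Metric.closedBall y₀ (r / 2) ⊆ U :=
    (Metric.closedBall_subset_ball (by linarith)).trans hrU
  -- The vector field `∂_z + Φ ∂_ζ`, cut off to make it global.
  let X : ℝ × ℝ → ℝ × ℝ := fun y => (1, χ y * Φ y)
  have hX : ContDiff ℝ ∞ X := by
    refine contDiff_const.prodMk (contDiff_iff_contDiffAt.2 fun y => ?_)
    by_cases hy : y ∈ U
    · exact χ.contDiff.contDiffAt.mul (hΦ.contDiffAt (hU.mem_nhds hy))
    · have h1 : y ∉ tsupport χ := fun h => hy (hballU (χ.tsupport_eq ▸ h))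
      refine contDiffAt_const (c := (0 : ℝ)) |>.congr_of_eventuallyEq ?_
      filter_upwards [notMem_tsupport_iff_eventuallyEq.1 h1] with x hx
      rw [hx, Pi.zero_apply, zero_mul]
  have hXball : ∀ y ∈ Metric.ball y₀ (r / 3), X y = (1, Φ y) := fun y hy => by
    simp only [X]
    rw [χ.one_of_mem_closedBall (Metric.ball_subset_closedBall hy), one_mul]
  obtain ⟨φ, W, hW, h0W, hφ, hφ0, hφX⟩ := exists_smooth_local_flow hX y₀
  let j : ℝ × ℝ → ℝ × ℝ × ℝ := fun q => (q.1, (y₀.1, q.2))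
  have hj : ContDiff ℝ ∞ j := by fun_prop
  let Ψ : ℝ × ℝ → ℝ × ℝ := fun q => φ (j q)
  have hW' : IsOpen (j ⁻¹' W) := hW.preimage hj.continuous
  have hΨ : ContDiffOn ℝ ∞ Ψ (j ⁻¹' W) := hφ.comp hj.contDiffOn (fun q hq => hq)
  have ha : ((0 : ℝ), y₀.2) ∈ j ⁻¹' W := h0W
  have hΨd : ∀ q ∈ j ⁻¹' W, HasFDerivAt Ψ (fderiv ℝ Ψ q) q := fun q hq =>
    ((hΨ.contDiffAt (hW'.mem_nhds hq)).differentiableAt (by simp)).hasFDerivAt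
  have hΨt : ∀ q ∈ j ⁻¹' W, HasDerivAt (fun t => Ψ (t, q.2)) (X (Ψ q)) q.1 :=
    fun q hq => hφX (j q) hq
  have hΨ0 : Ψ (0, y₀.2) = y₀ := hφ0 y₀ h0W
  have hcol1 : fderiv ℝ Ψ (0, y₀.2) (1, 0) = X y₀ := by
    have h1 : HasDerivAt (fun t : ℝ => (t, y₀.2)) ((1 : ℝ), (0 : ℝ)) 0 :=
      (hasDerivAt_id (0 : ℝ)).prodMk (hasDerivAt_const (0 : ℝ) y₀.2)
    have h2 := (hΨd _ ha).comp_hasDerivAt (0 : ℝ) h1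
    rw [h2.unique (hΨt _ ha), hΨ0]
  have hcol2 : fderiv ℝ Ψ (0, y₀.2) (0, 1) = (0, 1) := by
    have h1 : HasDerivAt (fun c : ℝ => ((0 : ℝ), c)) ((0 : ℝ), (1 : ℝ)) y₀.2 :=
      (hasDerivAt_const y₀.2 (0 : ℝ)).prodMk (hasDerivAt_id y₀.2)
    have h2 := (hΨd _ ha).comp_hasDerivAt y₀.2 h1
    have h3 : HasDerivAt (fun c : ℝ => (y₀.1, c)) ((0 : ℝ), (1 : ℝ)) y₀.2 :=
      (hasDerivAt_const y₀.2 y₀.1).prodMk (hasDerivAt_id y₀.2)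
    have hc : Continuous fun c : ℝ => ((0 : ℝ), c) := by fun_prop
    have h4 : (Ψ ∘ fun c : ℝ => ((0 : ℝ), c)) =ᶠ[nhds y₀.2] fun c : ℝ => (y₀.1, c) := by
      filter_upwards [(hW'.preimage hc).mem_nhds ha] with c hcW
      exact hφ0 (y₀.1, c) hcW
    exact h2.unique (h3.congr_of_eventuallyEq h4)
  let f' : (ℝ × ℝ) ≃L[ℝ] ℝ × ℝ := (ContinuousLinearEquiv.refl ℝ ℝ).skewProd
    (ContinuousLinearEquiv.refl ℝ ℝ) (ContinuousLinearMap.toSpanSingleton ℝ (Φ y₀))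
  have hf' : HasFDerivAt Ψ (f' : (ℝ × ℝ) →L[ℝ] ℝ × ℝ) (0, y₀.2) := by
    refine (hΨd _ ha).congr_fderiv ?_
    rw [hXball y₀ (Metric.mem_ball_self (by positivity))] at hcol1
    ext <;> simp [f', hcol1, hcol2]
  obtain ⟨e, hef, hae, heW, hes⟩ := exists_smooth_openPartialHomeomorph hW' hΨ ha hf'
  have hΨe : ∀ q ∈ e.source, e.symm (Ψ q) = q := fun q hq => by rw [← hef, e.left_inv hq]
  refine ⟨e.target ∩ Metric.ball y₀ (r / 3), fun y => (e.symm y).2,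
    e.open_target.inter Metric.isOpen_ball, ⟨?_, Metric.mem_ball_self (by positivity)⟩, ?_, ?_, ?_⟩
  · have := e.map_source hae
    rwa [hef, hΨ0] at this
  · exact fun y hy => hballU (Metric.ball_subset_closedBall
      (Metric.ball_subset_ball (by linarith) hy.2))
  · exact contDiff_snd.comp_contDiffOn (hes.mono Set.inter_subset_left)
  · intro y hy
    have hI : HasFDerivAt (fun y => (e.symm y).2) (fderiv ℝ (fun y => (e.symm y).2) y) y := by
      have : ContDiffAt ℝ ∞ (fun y => (e.symm y).2) y :=
        contDiff_snd.contDiffAt.comp y (hes.contDiffAt (e.open_target.mem_nhds hy.1))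
      exact (this.differentiableAt (by simp)).hasFDerivAt
    set q := e.symm y with hq
    have hqs : q ∈ e.source := e.map_target hy.1
    have hqy : Ψ q = y := by rw [← hef, e.right_inv hy.1]
    have hq1 : HasDerivAt (fun t : ℝ => (t, q.2)) ((1 : ℝ), (0 : ℝ)) q.1 :=
      (hasDerivAt_id q.1).prodMk (hasDerivAt_const q.1 q.2)
    have hq2 : HasDerivAt (fun c : ℝ => (q.1, c)) ((0 : ℝ), (1 : ℝ)) q.2 :=
      (hasDerivAt_const q.2 q.1).prodMk (hasDerivAt_id q.2)
    constructor
    · intro h0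
      have h1 : HasDerivAt (fun c : ℝ => Ψ (q.1, c)) (fderiv ℝ Ψ q (0, 1)) q.2 :=
        HasFDerivAt.comp_hasDerivAt (l := Ψ) (f := fun c : ℝ => (q.1, c)) q.2
          (hΨd q (heW hqs)) hq2
      have h2 : HasDerivAt (fun c : ℝ => (e.symm (Ψ (q.1, c))).2) 0 q.2 := by
        rw [h0, ← hqy] at hI
        exact HasFDerivAt.comp_hasDerivAt (l := fun y => (e.symm y).2)
          (f := fun c : ℝ => Ψ (q.1, c)) q.2 hI h1
      have h3 : (fun c : ℝ => (e.symm (Ψ (q.1, c))).2) =ᶠ[nhds q.2] fun c => c := by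
        filter_upwards [(e.open_source.preimage
          (f := fun c : ℝ => (q.1, c)) (by fun_prop)).mem_nhds hqs] with c hc
        rw [hΨe _ hc]
      exact zero_ne_one (h2.unique ((hasDerivAt_id q.2).congr_of_eventuallyEq h3))
    · have h1 := hΨt q (heW hqs)
      have h2 : HasDerivAt (fun t : ℝ => (e.symm (Ψ (t, q.2))).2)
          (fderiv ℝ (fun y => (e.symm y).2) y (X y)) q.1 := by
        rw [← hqy] at hI ⊢
        exact HasFDerivAt.comp_hasDerivAt (l := fun y => (e.symm y).2)
          (f := fun t : ℝ => Ψ (t, q.2)) q.1 hI h1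
      have h3 : (fun t : ℝ => (e.symm (Ψ (t, q.2))).2) =ᶠ[nhds q.1] fun _ => q.2 := by
        filter_upwards [(e.open_source.preimage
          (f := fun t : ℝ => (t, q.2)) (by fun_prop)).mem_nhds hqs] with t ht
        rw [hΨe _ ht]
      have h4 := h2.unique ((hasDerivAt_const q.1 q.2).congr_of_eventuallyEq h3)
      rw [hXball y hy.2, show ((1 : ℝ), Φ y) = (1, 0) + Φ y • (0, 1) by simp, map_add,
        map_smul, smul_eq_mul] at h4
      exact h4

/-! ### Calculus on the jet spaces -/

theorem isOpenMap_base : IsOpenMap base :=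
  IsOpenMap.id.prodMap (isOpenMap_fst (X := ℝ) (Y := ℝ))

theorem contDiff_base {n : WithTop ℕ∞} : ContDiff ℝ n base := by
  unfold base
  fun_prop

theorem hasFDerivAt_base (p : Jet) : HasFDerivAt base
    ((ContinuousLinearMap.fst ℝ ℝ (ℝ × ℝ)).prod
      ((ContinuousLinearMap.fst ℝ ℝ ℝ).comp (ContinuousLinearMap.snd ℝ ℝ (ℝ × ℝ)))) p :=
  hasFDerivAt_fst.prodMk (hasFDerivAt_fst.comp p hasFDerivAt_snd)

theorem hasFDerivAt_jet (q : Cov) : HasFDerivAt jet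
    ((ContinuousLinearMap.fst ℝ ℝ (ℝ × ℝ × ℝ)).prod
      (((ContinuousLinearMap.fst ℝ ℝ (ℝ × ℝ)).comp
        (ContinuousLinearMap.snd ℝ ℝ (ℝ × ℝ × ℝ))).prod
      ((ContinuousLinearMap.fst ℝ ℝ ℝ).comp ((ContinuousLinearMap.snd ℝ ℝ (ℝ × ℝ)).comp
        (ContinuousLinearMap.snd ℝ ℝ (ℝ × ℝ × ℝ)))))) q :=
  hasFDerivAt_fst.prodMk ((hasFDerivAt_fst.comp q hasFDerivAt_snd).prodMk
    (hasFDerivAt_fst.comp q (hasFDerivAt_snd.comp q hasFDerivAt_snd)))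

theorem map_plane (L : Plane →L[ℝ] ℝ) (a b : ℝ) :
    L (a, b) = a * L (1, 0) + b * L (0, 1) := by
  rw [show ((a, b) : Plane) = a • ((1, 0) : Plane) + b • ((0, 1) : Plane) by simp, map_add,
    map_smul, map_smul, smul_eq_mul, smul_eq_mul]

theorem map_jet (L : Jet →L[ℝ] ℝ) (a b c : ℝ) :
    L (a, b, c) = a * L (1, 0, 0) + b * L (0, 1, 0) + c * L (0, 0, 1) := by
  rw [show ((a, b, c) : Jet) =
      a • ((1, 0, 0) : Jet) + b • ((0, 1, 0) : Jet) + c • ((0, 0, 1) : Jet) by simp,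
    map_add, map_add, map_smul, map_smul, map_smul, smul_eq_mul, smul_eq_mul, smul_eq_mul]

variable {J : Set Jet}

theorem differentiableAt_of_contDiffOn_base (hJ : IsOpen J) {f : Plane → ℝ}
    (hf : ContDiffOn ℝ ∞ f (base '' J)) {p : Jet} (hp : p ∈ J) :
    DifferentiableAt ℝ f (base p) :=
  (hf.contDiffAt ((isOpenMap_base J hJ).mem_nhds (Set.mem_image_of_mem _ hp))).differentiableAt
    (by simp)

theorem differentiableAt_of_contDiffOn {E : Type*} [NormedAddCommGroup E] [NormedSpace ℝ E]
    {U : Set E} (hU : IsOpen U) {f : E → ℝ} (hf : ContDiffOn ℝ ∞ f U) {p : E} (hp : p ∈ U) :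
    DifferentiableAt ℝ f p :=
  (hf.contDiffAt (hU.mem_nhds hp)).differentiableAt (by simp)

theorem fderiv_comp_base_apply (hJ : IsOpen J) {f : Plane → ℝ}
    (hf : ContDiffOn ℝ ∞ f (base '' J)) {p : Jet} (hp : p ∈ J) (a b c : ℝ) :
    fderiv ℝ (fun p' : Jet => f (base p')) p (a, b, c) = fderiv ℝ f (base p) (a, b) := by
  have := (differentiableAt_of_contDiffOn_base hJ hf hp).hasFDerivAt.comp p (hasFDerivAt_base p)
  have h2 := this.fderiv
  change fderiv ℝ (fun p' : Jet => f (base p')) p = _ at h2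
  rw [h2]
  rfl

theorem contDiffOn_comp_base {f : Plane → ℝ} (hf : ContDiffOn ℝ ∞ f (base '' J)) :
    ContDiffOn ℝ ∞ (fun p => f (base p)) J :=
  hf.comp contDiff_base.contDiffOn (Set.mapsTo_image _ _)

theorem contDiffOn_totalD₀ (hJ : IsOpen J) {f : Plane → ℝ}
    (hf : ContDiffOn ℝ ∞ f (base '' J)) : ContDiffOn ℝ ∞ (totalD₀ f) J := by
  have h1 : ContDiffOn ℝ ∞ (fun p => fderiv ℝ f (base p)) J :=
    (hf.fderiv_of_isOpen (m := ∞) (isOpenMap_base J hJ) (by simp)).comp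
      contDiff_base.contDiffOn (Set.mapsTo_image _ _)
  exact h1.clm_apply (by fun_prop)

theorem contDiffOn_fderiv_apply {E : Type*} [NormedAddCommGroup E] [NormedSpace ℝ E] {U : Set E}
    (hU : IsOpen U) {f : E → ℝ} (hf : ContDiffOn ℝ ∞ f U) {w : E → E}
    (hw : ContDiffOn ℝ ∞ w U) : ContDiffOn ℝ ∞ (fun p => fderiv ℝ f p (w p)) U :=
  (hf.fderiv_of_isOpen (m := ∞) hU (by simp)).clm_apply hw

/-- Leibniz rule for the restricted total derivative of the product of a function of
`(t, x, x₁, w)` and a function of `(t, x, x₁)`. -/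
theorem fderiv_mul_comp_jet {Ω : Set Cov} (hΩ : IsOpen Ω) {k g : Cov → ℝ} {f : Jet → ℝ}
    (h : ∀ q ∈ Ω, k q = g q * f (jet q)) {q : Cov} (hq : q ∈ Ω)
    (hg : DifferentiableAt ℝ g q) (hf : DifferentiableAt ℝ f (jet q)) (a b c d : ℝ) :
    fderiv ℝ k q (a, b, c, d) =
      fderiv ℝ g q (a, b, c, d) * f (jet q) + g q * fderiv ℝ f (jet q) (a, b, c) := by
  have h1 : HasFDerivAt (fun q => f (jet q)) _ q := hf.hasFDerivAt.comp q (hasFDerivAt_jet q)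
  have h2 := hg.hasFDerivAt.mul h1
  have h3 : k =ᶠ[nhds q] fun q => g q * f (jet q) := by
    filter_upwards [hΩ.mem_nhds hq] with q' hq' using h q' hq'
  have h4 := (h2.congr_of_eventuallyEq h3).fderiv
  rw [h4]
  simp [mul_comm, add_comm]

/-! ### The λ-symmetry associated to a nonlocal symmetry -/

/-- The pair `P` is adapted to the functions `z`, `ζ`: these are invariants of the first
λ-prolongation of `X`, and neither the characteristic `Q` nor `ζ_{x₁}` vanishes. -/
structure IsAdapted (J : Set Jet) (z : Plane → ℝ) (ζ : Jet → ℝ) (P : LambdaPair) : Prop where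
  Q_ne : ∀ p ∈ J, P.Q p ≠ 0
  ζ_ne : ∀ p ∈ J, fderiv ℝ ζ p (0, 0, 1) ≠ 0
  invariant_z : ∀ p ∈ J, fderiv ℝ z (base p) (P.ρ (base p), P.φ (base p)) = 0
  invariant_ζ : ∀ p ∈ J, fderiv ℝ ζ p (P.ρ (base p), P.φ (base p), P.φ₁ p) = 0

variable {F H : Jet → ℝ} {Ω : Set Cov} {v : CovField} {z : Plane → ℝ} {ζ : Jet → ℝ}
  {G : ℝ × ℝ → ℝ → ℝ}

/-- If the components `ξ`, `η` of a covering symmetry have a common factor `g`, with quotients `ρ`,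
`φ` that depend on `(t, x)` only, then dividing by `g` yields a λ-symmetry with
`λ = D_t g / g`. That `λ` depends on `(t, x, x₁)` only is a consequence of the invariance
of `ζ`, which determines it. -/
theorem exists_lambdaSymmetry_of_common_factor (hJ : IsOpen J)
    (hv : IsCoveringSymmetry F J H Ω v) (hr : IsReduction F J H Ω v z ζ G)
    {ρ φ : Plane → ℝ} (hρ : ContDiffOn ℝ ∞ ρ (base '' J)) (hφ : ContDiffOn ℝ ∞ φ (base '' J))
    (hne : ∀ p ∈ J, ρ (base p) ≠ 0 ∨ φ (base p) ≠ 0)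
    {g : Cov → ℝ} (hg : ContDiffOn ℝ ∞ g Ω) (hg0 : ∀ q ∈ Ω, g q ≠ 0)
    (hξ : ∀ q ∈ Ω, v.ξ q = g q * ρ (base (jet q)))
    (hη : ∀ q ∈ Ω, v.η q = g q * φ (base (jet q))) :
    ∃ lam : Jet → ℝ, LambdaPair.IsLambdaSymmetry ⟨ρ, φ, lam⟩ F J ∧
      IsAdapted J z ζ ⟨ρ, φ, lam⟩ ∧
      ∀ q ∈ Ω, lam (jet q) = totalDOnSystem F H g q / g q := by
  have hΩJ : ∀ q ∈ Ω, jet q ∈ J := fun q hq => hv.image_eq ▸ Set.mem_image_of_mem jet hq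
  have hlift : ∀ p ∈ J, ∃ q ∈ Ω, jet q = p := fun p hp => by
    rw [← hv.image_eq] at hp
    exact hp
  have hz : ∀ p ∈ J, fderiv ℝ z (base p) (ρ (base p), φ (base p)) = 0 := by
    intro p hp
    obtain ⟨q, hq, rfl⟩ := hlift p hp
    have h := hr.invariant_z q hq
    rw [hξ q hq, hη q hq, map_plane] at h
    rw [map_plane]
    exact (mul_eq_zero.1 (by linear_combination h :
      g q * (ρ (base (jet q)) * fderiv ℝ z (base (jet q)) (1, 0) +
        φ (base (jet q)) * fderiv ℝ z (base (jet q)) (0, 1)) = 0)).resolve_left (hg0 q hq)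
  have hDz : ∀ p ∈ J,
      fderiv ℝ z (base p) (1, 0) + p.2.2 * fderiv ℝ z (base p) (0, 1) ≠ 0 := by
    intro p hp
    have h := hr.totalD_ne p hp
    unfold totalD₀ at h
    rwa [map_plane, one_mul] at h
  have hQ : ∀ p ∈ J, φ (base p) - ρ (base p) * p.2.2 ≠ 0 := by
    intro p hp h0
    have h1 := hz p hp
    rw [map_plane] at h1
    have h2 : ρ (base p) = 0 := (mul_eq_zero.1 (by
      linear_combination h1 - fderiv ℝ z (base p) (0, 1) * h0 :
      ρ (base p) * (fderiv ℝ z (base p) (1, 0) +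
        p.2.2 * fderiv ℝ z (base p) (0, 1)) = 0)).resolve_right (hDz p hp)
    have h3 : φ (base p) = 0 := by rw [h2] at h0; linarith
    exact (hne p hp).elim (fun h => h h2) (fun h => h h3)
  have hζ : ∀ p ∈ J, fderiv ℝ ζ p (0, 0, 1) ≠ 0 := by
    intro p hp h0
    obtain ⟨q, hq, rfl⟩ := hlift p hp
    have h1 := hz _ hp
    rw [map_plane] at h1
    have h2 := hr.invariant_ζ q hq
    rw [map_jet, h0, hξ q hq, hη q hq] at h2
    have h3 : ρ (base (jet q)) * fderiv ℝ ζ (jet q) (1, 0, 0) +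
        φ (base (jet q)) * fderiv ℝ ζ (jet q) (0, 1, 0) = 0 :=
      (mul_eq_zero.1 (by linear_combination h2 : g q * (ρ (base (jet q)) *
        fderiv ℝ ζ (jet q) (1, 0, 0) + φ (base (jet q)) *
          fderiv ℝ ζ (jet q) (0, 1, 0)) = 0)).resolve_left (hg0 q hq)
    -- The gradients of `z` and `ζ` in `(t, x)` are both orthogonal to `(ρ, φ) ≠ 0`.
    have hdet : fderiv ℝ z (base (jet q)) (0, 1) * fderiv ℝ ζ (jet q) (1, 0, 0) -
        fderiv ℝ ζ (jet q) (0, 1, 0) * fderiv ℝ z (base (jet q)) (1, 0) = 0 := by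
      rcases hne _ hp with h | h
      · refine (mul_eq_zero.1 ?_).resolve_left h
        linear_combination fderiv ℝ z (base (jet q)) (0, 1) * h3 -
          fderiv ℝ ζ (jet q) (0, 1, 0) * h1
      · refine (mul_eq_zero.1 ?_).resolve_left h
        linear_combination fderiv ℝ ζ (jet q) (1, 0, 0) * h1 -
          fderiv ℝ z (base (jet q)) (1, 0) * h3
    have hli := LinearIndependent.pair_iff.1 (hr.independent _ hp)
      (-(fderiv ℝ ζ (jet q) (1, 0, 0) + (jet q).2.2 * fderiv ℝ ζ (jet q) (0, 1, 0)))
      (fderiv ℝ z (base (jet q)) (1, 0) + (jet q).2.2 * fderiv ℝ z (base (jet q)) (0, 1)) (by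
        refine ContinuousLinearMap.ext fun ⟨a, b, c⟩ => ?_
        simp only [add_apply, smul_apply, smul_eq_mul,
          zero_apply]
        rw [fderiv_comp_base_apply hJ hr.smooth_z hp, map_plane, map_jet _ a b c, h0]
        linear_combination (a * (jet q).2.2 - b) * hdet)
    exact hDz _ hp hli.2
  let Q : Jet → ℝ := fun p => φ (base p) - ρ (base p) * p.2.2
  let B : Jet → ℝ := fun p => totalD₀ φ p - totalD₀ ρ p * p.2.2
  let lam : Jet → ℝ := fun p =>
    -(fderiv ℝ ζ p (ρ (base p), φ (base p), B p)) / (Q p * fderiv ℝ ζ p (0, 0, 1))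
  have hQs : ContDiffOn ℝ ∞ Q J :=
    (contDiffOn_comp_base hφ).sub ((contDiffOn_comp_base hρ).mul (by fun_prop))
  have hBs : ContDiffOn ℝ ∞ B J :=
    (contDiffOn_totalD₀ hJ hφ).sub ((contDiffOn_totalD₀ hJ hρ).mul (by fun_prop))
  have hlams : ContDiffOn ℝ ∞ lam J :=
    (contDiffOn_fderiv_apply hJ hr.smooth_ζ ((contDiffOn_comp_base hρ).prodMk
      ((contDiffOn_comp_base hφ).prodMk hBs))).neg.div
      (hQs.mul (contDiffOn_fderiv_apply hJ hr.smooth_ζ contDiffOn_const))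
      (fun p hp => mul_ne_zero (hQ p hp) (hζ p hp))
  have hφ₁ : ∀ p, LambdaPair.φ₁ ⟨ρ, φ, lam⟩ p = B p + lam p * Q p := fun p => rfl
  have hφ₁s : ContDiffOn ℝ ∞ (LambdaPair.φ₁ ⟨ρ, φ, lam⟩) J := hBs.add (hlams.mul hQs)
  have hlamQ : ∀ p ∈ J, lam p * Q p * fderiv ℝ ζ p (0, 0, 1) =
      -(fderiv ℝ ζ p (ρ (base p), φ (base p), B p)) := by
    intro p hp
    have h1 : Q p ≠ 0 := hQ p hp
    have h2 := hζ p hp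
    simp only [lam]
    field_simp
  have hDprod : ∀ (k : Cov → ℝ) (f : Plane → ℝ), ContDiffOn ℝ ∞ f (base '' J) →
      (∀ q ∈ Ω, k q = g q * f (base (jet q))) → ∀ q ∈ Ω, ∀ b c,
      fderiv ℝ k q (1, q.2.2.1, b, c) =
        fderiv ℝ g q (1, q.2.2.1, b, c) * f (base (jet q)) + g q * totalD₀ f (jet q) := by
    intro k f hf hk q hq b c
    rw [fderiv_mul_comp_jet hv.isOpen (f := fun p => f (base p)) hk hq
      (differentiableAt_of_contDiffOn hv.isOpen hg hq)
      (differentiableAt_of_contDiffOn hJ (contDiffOn_comp_base hf) (hΩJ q hq)),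
      fderiv_comp_base_apply hJ hf (hΩJ q hq)]
    rfl
  have hη₁ : ∀ q ∈ Ω, v.η₁OnSystem F H q =
      totalDOnSystem F H g q * Q (jet q) + g q * B (jet q) := by
    intro q hq
    unfold CovField.η₁OnSystem CovField.η₁ totalDCov
    rw [hDprod _ φ hφ hη q hq, hDprod _ ρ hρ hξ q hq]
    simp only [totalDOnSystem, totalDCov, Q, B, jet]
    ring
  have hlamg : ∀ q ∈ Ω, lam (jet q) = totalDOnSystem F H g q / g q := by
    intro q hq
    have hp := hΩJ q hq
    have h1 := hr.invariant_ζ q hq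
    have h2 := hlamQ _ hp
    rw [map_jet, hη₁ q hq, hξ q hq, hη q hq] at h1
    rw [map_jet _ (ρ _)] at h2
    rw [eq_div_iff (hg0 q hq)]
    have h3 : Q (jet q) * fderiv ℝ ζ (jet q) (0, 0, 1) ≠ 0 := mul_ne_zero (hQ _ hp) (hζ _ hp)
    refine mul_right_cancel₀ h3 ?_
    linear_combination g q * h2 - h1
  have hη₁' : ∀ q ∈ Ω, v.η₁OnSystem F H q = g q * LambdaPair.φ₁ ⟨ρ, φ, lam⟩ (jet q) := by
    intro q hq
    have h1 := hg0 q hq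
    rw [hη₁ q hq, hφ₁, hlamg q hq]
    field_simp
    ring
  refine ⟨lam, ⟨hρ, hφ, hlams, ?_⟩, ⟨hQ, hζ, hz, ?_⟩, hlamg⟩
  · rintro p hp x₂ rfl
    obtain ⟨q, hq, rfl⟩ := hlift p hp
    have h1 := (hv.symmetry q hq _ _ _ rfl rfl rfl).2.1
    unfold prolong at h1
    rw [hDprod _ ρ hρ hξ q hq, fderiv_mul_comp_jet hv.isOpen hη₁' hq
      (differentiableAt_of_contDiffOn hv.isOpen hg hq)
      (differentiableAt_of_contDiffOn hJ hφ₁s hp), map_jet (fderiv ℝ F (jet q)),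
      hξ q hq, hη q hq, hη₁' q hq] at h1
    have h2 : lam (jet q) * g q = fderiv ℝ g q (1, q.2.2.1, F (jet q), H (jet q)) := by
      rw [hlamg q hq, div_mul_cancel₀ _ (hg0 q hq)]
      rfl
    refine (mul_eq_zero.1 (?_ : g q * _ = 0)).resolve_left (hg0 q hq)
    rw [map_jet (fderiv ℝ F (jet q))]
    unfold LambdaPair.φ₂ totalD₁
    simp only
    change _ * _ + g q * fderiv ℝ _ (jet q) (1, (jet q).2.2, F (jet q)) - _ - _ = 0 at h1
    linear_combination h1 + (LambdaPair.φ₁ ⟨ρ, φ, lam⟩ (jet q) -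
      ρ (base (jet q)) * F (jet q)) * h2
  · intro p hp
    have h1 := hlamQ p hp
    rw [map_jet _ (ρ _)] at h1
    rw [map_jet, hφ₁]
    linear_combination h1

/-- The pair associated to a nonlocal symmetry exists, is a λ-symmetry, and is adapted to the
invariants of the reduction. -/
theorem exists_associatedPair (hJ : IsOpen J) (hv : IsCoveringSymmetry F J H Ω v)
    (hr : IsReduction F J H Ω v z ζ G) (hc : CaseOne Ω v ∨ CaseTwo Ω v) :
    ∃ P : LambdaPair, IsAssociatedPair F H Ω v P ∧ P.IsLambdaSymmetry F J ∧
      IsAdapted J z ζ P := by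
  have hM : IsOpen (base '' J) := isOpenMap_base J hJ
  rcases hc with hc | hc
  · -- Invariance of `z` gives `η/ξ = -z_t/z_x`, which shows that `η/ξ` depends on `(t, x)` only.
    have hzx : ∀ b ∈ base '' J, fderiv ℝ z b (0, 1) ≠ 0 := by
      rintro _ ⟨p, hp, rfl⟩ h0
      obtain ⟨q, hq, rfl⟩ : p ∈ jet '' Ω := hv.image_eq ▸ hp
      have h1 := hr.invariant_z q hq
      rw [map_plane, h0, mul_zero, add_zero] at h1
      have h2 := (mul_eq_zero.1 h1).resolve_left (hc q hq)
      refine hr.totalD_ne _ hp ?_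
      unfold totalD₀
      rw [map_plane, h0, h2]
      simp
    let φ : Plane → ℝ := fun b => -(fderiv ℝ z b (1, 0)) / fderiv ℝ z b (0, 1)
    have hφ : ContDiffOn ℝ ∞ φ (base '' J) :=
      (contDiffOn_fderiv_apply hM hr.smooth_z contDiffOn_const).neg.div
        (contDiffOn_fderiv_apply hM hr.smooth_z contDiffOn_const) hzx
    have hη : ∀ q ∈ Ω, v.η q = v.ξ q * φ (base (jet q)) := by
      intro q hq
      have h1 := hr.invariant_z q hq
      have h2 := hzx (base (jet q))
        (Set.mem_image_of_mem _ (hv.image_eq ▸ Set.mem_image_of_mem jet hq))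
      rw [map_plane] at h1
      simp only [φ]
      field_simp
      linear_combination h1
    obtain ⟨lam, h1, h2, h3⟩ := exists_lambdaSymmetry_of_common_factor hJ hv hr
      (ρ := fun _ => 1) contDiffOn_const hφ (fun _ _ => Or.inl one_ne_zero) hv.smooth_ξ hc
      (fun q _ => (mul_one _).symm) hη
    refine ⟨_, Or.inl ⟨hc, fun q hq => ⟨rfl, ?_, h3 q hq⟩⟩, h1, h2⟩
    rw [hη q hq, mul_div_cancel_left₀ _ (hc q hq)]
  · obtain ⟨lam, h1, h2, h3⟩ := exists_lambdaSymmetry_of_common_factor hJ hv hr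
      (ρ := fun _ => 0) (φ := fun _ => 1) contDiffOn_const contDiffOn_const
      (fun _ _ => Or.inr one_ne_zero) hv.smooth_η (fun q hq => (hc q hq).2)
      (fun q hq => by rw [mul_zero]; exact (hc q hq).1) (fun q _ => (mul_one _).symm)
    exact ⟨_, Or.inr ⟨hc, fun q hq => ⟨rfl, rfl, h3 q hq⟩⟩, h1, h2⟩

/-! ### The reduced equation and its invariants -/

variable {P : LambdaPair}

theorem contDiffOn_newCoords (hr : IsReduction F J H Ω v z ζ G) :
    ContDiffOn ℝ ∞ (newCoords z ζ) J :=
  (contDiffOn_comp_base hr.smooth_z).prodMk hr.smooth_ζ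

theorem contDiffOn_zetaDeriv (hJ : IsOpen J) (hF : ContDiffOn ℝ ∞ F J)
    (hr : IsReduction F J H Ω v z ζ G) :
    ContDiffOn ℝ ∞ (fun p => zetaDeriv z ζ p (F p)) J :=
  (contDiffOn_fderiv_apply hJ hr.smooth_ζ (contDiffOn_const.prodMk
    (ContDiffOn.prodMk (by fun_prop) hF))).div (contDiffOn_totalD₀ hJ hr.smooth_z) hr.totalD_ne

/-- Since `ζ_z` is a bijective affine function of `x₂`, the reduced equation can be solved for
the derivative, and its solution is the value of `ζ_z` on `x₂ = F`. -/
theorem reduced_eq_zero_iff (hr : IsReduction F J H Ω v z ζ G) (hP : IsAdapted J z ζ P)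
    {p : Jet} (hp : p ∈ J) (s : ℝ) :
    G (newCoords z ζ p) s = 0 ↔ s = zetaDeriv z ζ p (F p) := by
  have h1 := hP.ζ_ne p hp
  have h2 := hr.totalD_ne p hp
  constructor
  · intro hs
    have h3 : zetaDeriv z ζ p ((s * totalD₀ z p - fderiv ℝ ζ p (1, 0, 0) -
        p.2.2 * fderiv ℝ ζ p (0, 1, 0)) / fderiv ℝ ζ p (0, 0, 1)) = s := by
      unfold zetaDeriv totalD₁
      rw [map_jet _ 1]
      field_simp
      ring
    rw [← h3] at hs
    rw [← (hr.equation p hp _).2 hs, h3]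
  · rintro rfl
    exact (hr.equation p hp _).1 rfl

theorem fderiv_comp_newCoords (hJ : IsOpen J) (hr : IsReduction F J H Ω v z ζ G)
    {I : ℝ × ℝ → ℝ} {p : Jet} (hp : p ∈ J) (hI : DifferentiableAt ℝ I (newCoords z ζ p))
    (a b c : ℝ) :
    fderiv ℝ (fun p' => I (newCoords z ζ p')) p (a, b, c) =
      fderiv ℝ z (base p) (a, b) * fderiv ℝ I (newCoords z ζ p) (1, 0) +
        fderiv ℝ ζ p (a, b, c) * fderiv ℝ I (newCoords z ζ p) (0, 1) := by
  have h1 : HasFDerivAt (fun p' : Jet => z (base p'))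
      (fderiv ℝ (fun p' : Jet => z (base p')) p) p :=
    (differentiableAt_of_contDiffOn hJ (contDiffOn_comp_base hr.smooth_z) hp).hasFDerivAt
  have h2 := (differentiableAt_of_contDiffOn hJ hr.smooth_ζ hp).hasFDerivAt
  have h3 : HasFDerivAt (fun p' => I (newCoords z ζ p')) _ p :=
    hI.hasFDerivAt.comp p (h1.prodMk h2)
  rw [h3.fderiv, ContinuousLinearMap.comp_apply, ContinuousLinearMap.prod_apply,
    fderiv_comp_base_apply hJ hr.smooth_z hp, map_plane]

/-- The common kernel of `dz` and `dζ` is spanned by the first λ-prolongation of `X`. -/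
theorem exists_eq_smul_of_mem_ker (hr : IsReduction F J H Ω v z ζ G) (hP : IsAdapted J z ζ P)
    {p : Jet} (hp : p ∈ J) {a b c : ℝ} (hz : fderiv ℝ z (base p) (a, b) = 0)
    (hζ : fderiv ℝ ζ p (a, b, c) = 0) :
    ∃ k : ℝ, a = k * P.ρ (base p) ∧ b = k * P.φ (base p) ∧ c = k * P.φ₁ p := by
  have hQ : P.φ (base p) - P.ρ (base p) * p.2.2 ≠ 0 := hP.Q_ne p hp
  have hD := hr.totalD_ne p hp
  have h1 := hP.invariant_z p hp
  have h2 := hP.invariant_ζ p hp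
  unfold totalD₀ at hD
  rw [map_plane] at hz h1 hD
  rw [map_jet] at hζ h2
  have hdet : a * P.φ (base p) - b * P.ρ (base p) = 0 := by
    refine (mul_eq_zero.1 (?_ : _ * (1 * fderiv ℝ z (base p) (1, 0) +
      p.2.2 * fderiv ℝ z (base p) (0, 1)) = 0)).resolve_right hD
    linear_combination (P.φ (base p) - p.2.2 * P.ρ (base p)) * hz - (b - p.2.2 * a) * h1
  have ha : a = (b - p.2.2 * a) / (P.φ (base p) - P.ρ (base p) * p.2.2) * P.ρ (base p) := by
    rw [div_mul_eq_mul_div, eq_div_iff hQ]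
    linear_combination hdet
  have hb : b = (b - p.2.2 * a) / (P.φ (base p) - P.ρ (base p) * p.2.2) * P.φ (base p) := by
    rw [div_mul_eq_mul_div, eq_div_iff hQ]
    linear_combination p.2.2 * hdet
  refine ⟨_, ha, hb, sub_eq_zero.1 ((mul_eq_zero.1
    (?_ : _ * fderiv ℝ ζ p (0, 0, 1) = 0)).resolve_right (hP.ζ_ne p hp))⟩
  generalize (b - p.2.2 * a) / (P.φ (base p) - P.ρ (base p) * p.2.2) = k at ha hb
  rw [ha, hb] at hζ
  linear_combination hζ - k * h2

/-- Near each point of `J`, the functions `z`, `ζ` can be completed to smooth coordinates. -/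
theorem exists_coordinates (hJ : IsOpen J) (hr : IsReduction F J H Ω v z ζ G)
    (hP : IsAdapted J z ζ P) {p : Jet} (hp : p ∈ J) :
    ∃ e : OpenPartialHomeomorph Jet ((ℝ × ℝ) × ℝ), (∀ x, (e x).1 = newCoords z ζ x) ∧
      p ∈ e.source ∧ e.source ⊆ J ∧ ContDiffOn ℝ ∞ e.symm e.target := by
  -- The third coordinate is a linear form in `(t, x)` that is positive on `X` at `p`.
  let Θ : Jet → (ℝ × ℝ) × ℝ := fun x =>
    (newCoords z ζ x, P.ρ (base p) * x.1 + P.φ (base p) * x.2.1)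
  have hΘ : ContDiffOn ℝ ∞ Θ J := (contDiffOn_newCoords hr).prodMk (by fun_prop)
  have h1 : HasFDerivAt (fun p' : Jet => z (base p'))
      (fderiv ℝ (fun p' : Jet => z (base p')) p) p :=
    (differentiableAt_of_contDiffOn hJ (contDiffOn_comp_base hr.smooth_z) hp).hasFDerivAt
  have h2 := (differentiableAt_of_contDiffOn hJ hr.smooth_ζ hp).hasFDerivAt
  have hx : HasFDerivAt (fun x : Jet => x.2.1) _ p :=
    (hasFDerivAt_base p).snd
  have h3 : HasFDerivAt (fun x : Jet => P.ρ (base p) * x.1 + P.φ (base p) * x.2.1) _ p :=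
    (hasFDerivAt_fst.const_mul (P.ρ (base p))).add (hx.const_mul (P.φ (base p)))
  have h4 : HasFDerivAt Θ _ p := (h1.prodMk h2).prodMk h3
  have hinj : Function.Injective (fderiv ℝ Θ p) := by
    rw [injective_iff_map_eq_zero]
    rintro ⟨a, b, c⟩ h0
    rw [h4.fderiv] at h0
    have hz : fderiv ℝ z (base p) (a, b) = 0 := by
      rw [← fderiv_comp_base_apply hJ hr.smooth_z hp a b c]
      exact congrArg (fun y : (ℝ × ℝ) × ℝ => y.1.1) h0
    have hζ : fderiv ℝ ζ p (a, b, c) = 0 := congrArg (fun y : (ℝ × ℝ) × ℝ => y.1.2) h0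
    have hc : P.ρ (base p) * a + P.φ (base p) * b = 0 :=
      congrArg (fun y : (ℝ × ℝ) × ℝ => y.2) h0
    obtain ⟨k, rfl, rfl, rfl⟩ := exists_eq_smul_of_mem_ker hr hP hp hz hζ
    have hk : k = 0 := by
      have hpos : P.ρ (base p) ^ 2 + P.φ (base p) ^ 2 ≠ 0 := by
        intro h
        have h5 : P.ρ (base p) = 0 := by
          nlinarith only [h, sq_nonneg (P.ρ (base p)), sq_nonneg (P.φ (base p))]
        have h6 : P.φ (base p) = 0 := by
          nlinarith only [h, sq_nonneg (P.ρ (base p)), sq_nonneg (P.φ (base p))]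
        refine hP.Q_ne p hp ?_
        unfold LambdaPair.Q
        rw [h5, h6]
        simp
      refine (mul_eq_zero.1 (?_ : _ * (P.ρ (base p) ^ 2 + P.φ (base p) ^ 2) = 0)).resolve_right hpos
      linear_combination hc
    simp [hk]
  let Θ' : Jet ≃L[ℝ] (ℝ × ℝ) × ℝ :=
    (LinearEquiv.ofInjectiveOfFinrankEq (fderiv ℝ Θ p : Jet →ₗ[ℝ] (ℝ × ℝ) × ℝ) hinj
      (by simp)).toContinuousLinearEquiv
  have hΘ' : HasFDerivAt Θ (Θ' : Jet →L[ℝ] (ℝ × ℝ) × ℝ) p := by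
    refine h4.differentiableAt.hasFDerivAt.congr_fderiv ?_
    ext <;> rfl
  obtain ⟨e, h5, h6, h7, h8⟩ := exists_smooth_openPartialHomeomorph hJ hΘ hp hΘ'
  exact ⟨e, fun x => by rw [h5], h6, h7, h8⟩

/-- A function whose differential vanishes on the common kernel of `dz` and `dζ` is locally a
smooth function of `z` and `ζ`. -/
theorem exists_factorization (hJ : IsOpen J) (hr : IsReduction F J H Ω v z ζ G)
    (hP : IsAdapted J z ζ P) {U : Set Jet} (hU : IsOpen U) (hUJ : U ⊆ J) {f : Jet → ℝ}
    (hf : ContDiffOn ℝ ∞ f U)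
    (hker : ∀ p ∈ U, fderiv ℝ f p (P.ρ (base p), P.φ (base p), P.φ₁ p) = 0)
    {p : Jet} (hp : p ∈ U) :
    ∃ (U' : Set Jet) (V : Set (ℝ × ℝ)) (I : ℝ × ℝ → ℝ), IsOpen U' ∧ p ∈ U' ∧ U' ⊆ U ∧ IsOpen V ∧
      newCoords z ζ '' U' = V ∧ ContDiffOn ℝ ∞ I V ∧
      ∀ p' ∈ U', f p' = I (newCoords z ζ p') := by
  obtain ⟨e, he, hpe, heJ, hes⟩ := exists_coordinates hJ hr hP (hUJ hp)
  have hT : IsOpen (e.target ∩ e.symm ⁻¹' U) := e.isOpen_inter_preimage_symm hU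
  obtain ⟨r, hr0, hball⟩ := Metric.isOpen_iff.1 hT (e p)
    ⟨e.map_source hpe, by rw [Set.mem_preimage, e.left_inv hpe]; exact hp⟩
  have hfe : ContDiffOn ℝ ∞ (fun y => f (e.symm y)) (e.target ∩ e.symm ⁻¹' U) :=
    hf.comp (hes.mono Set.inter_subset_left) (fun y hy => hy.2)
  have hbox : ∀ (y : ℝ × ℝ) (c : ℝ), y ∈ Metric.ball (e p).1 r → c ∈ Metric.ball (e p).2 r →
      (y, c) ∈ e.target ∩ e.symm ⁻¹' U := fun y c hy hc => hball (by
    rw [Metric.mem_ball, Prod.dist_eq, max_lt_iff]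
    exact ⟨hy, hc⟩)
  have hc0 : (e p).2 ∈ Metric.ball (e p).2 r := Metric.mem_ball_self hr0
  have hconst : ∀ y ∈ Metric.ball (e p).1 r, ∀ c ∈ Metric.ball (e p).2 r,
      f (e.symm (y, c)) = f (e.symm (y, (e p).2)) := by
    intro y hy c hc
    have hder : ∀ c ∈ Metric.ball (e p).2 r,
        HasDerivAt (fun c => f (e.symm (y, c))) 0 c := by
      intro c hc
      have hmem := hbox y c hy hc
      have hx : e.symm (y, c) ∈ U := hmem.2
      have hl : HasDerivAt (fun c : ℝ => (y, c)) ((0 : ℝ × ℝ), (1 : ℝ)) c :=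
        (hasDerivAt_const c y).prodMk (hasDerivAt_id c)
      have hsd : HasFDerivAt e.symm (fderiv ℝ e.symm (y, c)) (y, c) :=
        ((hes.contDiffAt (e.open_target.mem_nhds hmem.1)).differentiableAt (by simp)).hasFDerivAt
      have hγ := HasFDerivAt.comp_hasDerivAt (l := e.symm) (f := fun c : ℝ => (y, c)) c hsd hl
      obtain ⟨a, b, d, hw⟩ : ∃ a b d : ℝ, fderiv ℝ e.symm (y, c) (0, 1) = (a, b, d) :=
        ⟨_, _, _, rfl⟩
      rw [hw] at hγ
      -- `z` and `ζ` are constant along the curve `c ↦ e.symm (y, c)`.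
      have hev : ∀ᶠ c' in nhds c, newCoords z ζ (e.symm (y, c')) = y := by
        filter_upwards [(e.open_target.preimage
          (f := fun c' : ℝ => (y, c')) (by fun_prop)).mem_nhds hmem.1] with c' hc'
        rw [← he, e.right_inv hc']
      have hz : fderiv ℝ z (base (e.symm (y, c))) (a, b) = 0 := by
        rw [← fderiv_comp_base_apply hJ hr.smooth_z (hUJ hx) a b d]
        have h1 := HasFDerivAt.comp_hasDerivAt (l := fun p' : Jet => z (base p')) c
          (differentiableAt_of_contDiffOn hJ (contDiffOn_comp_base hr.smooth_z)
            (hUJ hx)).hasFDerivAt hγ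
        refine h1.unique ((hasDerivAt_const c y.1).congr_of_eventuallyEq ?_)
        filter_upwards [hev] with c' hc' using congrArg Prod.fst hc'
      have hζ : fderiv ℝ ζ (e.symm (y, c)) (a, b, d) = 0 := by
        have h1 := HasFDerivAt.comp_hasDerivAt (l := ζ) c
          (differentiableAt_of_contDiffOn hJ hr.smooth_ζ (hUJ hx)).hasFDerivAt hγ
        refine h1.unique ((hasDerivAt_const c y.2).congr_of_eventuallyEq ?_)
        filter_upwards [hev] with c' hc' using congrArg Prod.snd hc'
      obtain ⟨k, hka, hkb, hkd⟩ := exists_eq_smul_of_mem_ker hr hP (hUJ hx) hz hζ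
      have h2 := HasFDerivAt.comp_hasDerivAt (l := f) c
        (differentiableAt_of_contDiffOn hU hf hx).hasFDerivAt hγ
      refine h2.congr_deriv ?_
      have h3 : ((a, b, d) : Jet) = k • (P.ρ (base (e.symm (y, c))), P.φ (base (e.symm (y, c))),
          P.φ₁ (e.symm (y, c))) := by
        rw [hka, hkb, hkd]
        rfl
      rw [h3, map_smul, hker _ hx, smul_zero]
    exact Metric.isOpen_ball.is_const_of_deriv_eq_zero (convex_ball _ _).isPreconnected
      (fun c hc => (hder c hc).differentiableAt.differentiableWithinAt)
      (fun c hc => (hder c hc).deriv) hc hc0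
  refine ⟨e.source ∩ e ⁻¹' Metric.ball (e p) r, Metric.ball (e p).1 r,
    fun y => f (e.symm (y, (e p).2)), e.isOpen_inter_preimage Metric.isOpen_ball,
    ⟨hpe, Metric.mem_ball_self hr0⟩, ?_, Metric.isOpen_ball, ?_, ?_, ?_⟩
  · intro x hx
    have := (hball hx.2).2
    rwa [Set.mem_preimage, e.left_inv hx.1] at this
  · ext y
    constructor
    · rintro ⟨x, hx, rfl⟩
      rw [← he]
      have := hx.2
      rw [Set.mem_preimage, Metric.mem_ball, Prod.dist_eq, max_lt_iff] at this
      exact this.1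
    · intro hy
      have hmem := (hbox y _ hy hc0).1
      refine ⟨e.symm (y, (e p).2), ⟨e.map_target hmem, ?_⟩, ?_⟩
      · rw [Set.mem_preimage, e.right_inv hmem, Metric.mem_ball, Prod.dist_eq, max_lt_iff]
        exact ⟨hy, hc0⟩
      · rw [← he, e.right_inv hmem]
  · exact hfe.comp (by fun_prop : ContDiff ℝ ∞ fun y : ℝ × ℝ => (y, (e p).2)).contDiffOn
      (fun y hy => hbox y _ hy hc0)
  · intro x hx
    have h1 := hx.2
    rw [Set.mem_preimage, Metric.mem_ball, Prod.dist_eq, max_lt_iff] at h1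
    have h2 := hconst _ h1.1 _ h1.2
    rw [Prod.mk.eta, e.left_inv hx.1, he] at h2
    exact h2

/-- As a function of `(t, x, x₁)`, a first integral of the reduced equation is annihilated by `A`
and by the first λ-prolongation of `X`, and its differential does not vanish. -/
theorem IsFirstIntegral.fderiv_comp_newCoords (hJ : IsOpen J) (hr : IsReduction F J H Ω v z ζ G)
    (hP : IsAdapted J z ζ P) {V : Set (ℝ × ℝ)} {I : ℝ × ℝ → ℝ} (hI : IsFirstIntegral G V I)
    {p : Jet} (hp : p ∈ J) (hpV : newCoords z ζ p ∈ V) :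
    fderiv ℝ (fun p' => I (newCoords z ζ p')) p (1, p.2.2, F p) = 0 ∧
    fderiv ℝ (fun p' => I (newCoords z ζ p')) p (P.ρ (base p), P.φ (base p), P.φ₁ p) = 0 ∧
    fderiv ℝ (fun p' => I (newCoords z ζ p')) p ≠ 0 := by
  obtain ⟨hV, hIs, hI'⟩ := hI
  obtain ⟨hne, hDI⟩ := hI' _ hpV
  have hId := differentiableAt_of_contDiffOn hV hIs hpV
  have hD : fderiv ℝ z (base p) (1, p.2.2) ≠ 0 := hr.totalD_ne p hp
  have hA : fderiv ℝ (fun p' => I (newCoords z ζ p')) p (1, p.2.2, F p) = 0 := by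
    have h1 := hDI _ ((reduced_eq_zero_iff hr hP hp _).2 rfl)
    unfold zetaDeriv totalD₁ totalD₀ at h1
    rw [NonlocalReduction.fderiv_comp_newCoords hJ hr hp hId]
    field_simp at h1
    linear_combination h1
  refine ⟨hA, ?_, fun h0 => hne ?_⟩
  · rw [NonlocalReduction.fderiv_comp_newCoords hJ hr hp hId, hP.invariant_z p hp,
      hP.invariant_ζ p hp]
    simp
  · have h1 : fderiv ℝ I (newCoords z ζ p) (0, 1) = 0 := by
      have h2 := NonlocalReduction.fderiv_comp_newCoords hJ hr hp hId 0 0 1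
      rw [h0, map_plane] at h2
      simpa [hP.ζ_ne p hp] using h2.symm
    have h3 : fderiv ℝ I (newCoords z ζ p) (1, 0) = 0 := by
      rw [NonlocalReduction.fderiv_comp_newCoords hJ hr hp hId, h1, mul_zero, add_zero] at hA
      exact (mul_eq_zero.1 hA).resolve_left hD
    refine ContinuousLinearMap.ext fun ⟨a, b⟩ => ?_
    rw [map_plane, h1, h3]
    simp

/-- Existence of first integrals: solving the reduced equation for the derivative along a local
section of `(z, ζ)` gives a smooth first-order equation in normal form. -/
theorem exists_isFirstIntegral (hJ : IsOpen J) (hF : ContDiffOn ℝ ∞ F J)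
    (hr : IsReduction F J H Ω v z ζ G) (hP : IsAdapted J z ζ P) {p : Jet} (hp : p ∈ J) :
    ∃ (V : Set (ℝ × ℝ)) (I : ℝ × ℝ → ℝ), IsFirstIntegral G V I ∧ newCoords z ζ p ∈ V := by
  obtain ⟨e, he, hpe, heJ, hes⟩ := exists_coordinates hJ hr hP hp
  have hl : ContDiff ℝ ∞ fun y : ℝ × ℝ => (y, (e p).2) := by fun_prop
  have hp0 : (newCoords z ζ p, (e p).2) = e p := by rw [← he]
  have hσ : ∀ y : ℝ × ℝ, (y, (e p).2) ∈ e.target →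
      e.symm (y, (e p).2) ∈ J ∧ newCoords z ζ (e.symm (y, (e p).2)) = y := fun y hy =>
    ⟨heJ (e.map_target hy), by rw [← he, e.right_inv hy]⟩
  have hΦ : ContDiffOn ℝ ∞
      (fun y : ℝ × ℝ => zetaDeriv z ζ (e.symm (y, (e p).2)) (F (e.symm (y, (e p).2))))
      ((fun y : ℝ × ℝ => (y, (e p).2)) ⁻¹' e.target) :=
    (contDiffOn_zetaDeriv hJ hF hr).comp (hes.comp hl.contDiffOn fun y hy => hy)
      (fun y hy => (hσ y hy).1)
  obtain ⟨V, I, hV, hpV, hVU, hI, hI'⟩ := exists_first_integral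
    (e.open_target.preimage hl.continuous) hΦ
    (show (newCoords z ζ p, (e p).2) ∈ e.target from hp0 ▸ e.map_source hpe)
  refine ⟨V, I, ⟨hV, hI, fun y hy => ⟨(hI' y hy).1, fun s hs => ?_⟩⟩, hpV⟩
  obtain ⟨h1, h2⟩ := hσ y (hVU hy)
  have h3 := (reduced_eq_zero_iff hr hP h1 s).1 (by rw [h2]; exact hs)
  rw [h3]
  exact (hI' y hy).2

/-! ### `A`-equivalence and functional dependence -/

/-- The first λ-prolongation of `X` is `ρ A + Q (∂_x + κ ∂_{x₁})`, where `κ = λ + A(Q)/Q`. -/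
theorem prolongation_eq (hJ : IsOpen J) (hP : P.IsLambdaSymmetry F J) {p : Jet} (hp : p ∈ J)
    (hQ : P.Q p ≠ 0) :
    ((P.ρ (base p), P.φ (base p), P.φ₁ p) : Jet) = P.ρ (base p) • ((1, p.2.2, F p) : Jet) +
      P.Q p • ((0, 1, P.lam p + vfA F P.Q p / P.Q p) : Jet) := by
  have hρ := differentiableAt_of_contDiffOn hJ (contDiffOn_comp_base hP.1) hp
  have hφ := differentiableAt_of_contDiffOn hJ (contDiffOn_comp_base hP.2.1) hp
  have h1 : HasFDerivAt P.Q _ p := hφ.hasFDerivAt.sub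
    (hρ.hasFDerivAt.mul (hasFDerivAt_snd.comp p (hasFDerivAt_snd (p := p))))
  have h2 : vfA F P.Q p = totalD₀ P.φ p - totalD₀ P.ρ p * p.2.2 - P.ρ (base p) * F p := by
    unfold vfA totalD₁
    rw [h1.fderiv]
    simp only [sub_apply, add_apply, smul_apply, ContinuousLinearMap.comp_apply,
      ContinuousLinearMap.coe_snd', smul_eq_mul]
    rw [fderiv_comp_base_apply hJ hP.1 hp, fderiv_comp_base_apply hJ hP.2.1 hp]
    unfold totalD₀
    ring
  have h3 : P.φ₁ p = P.ρ (base p) * F p + P.Q p * (P.lam p + vfA F P.Q p / P.Q p) := by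
    rw [mul_add, mul_div_cancel₀ _ hQ, h2]
    unfold LambdaPair.φ₁ LambdaPair.Q
    ring
  ext
  · simp
  · simp [LambdaPair.Q]
  · simp [h3]

theorem map_prolongation_eq_zero_iff (hJ : IsOpen J) (hP : P.IsLambdaSymmetry F J) {p : Jet}
    (hp : p ∈ J) (hQ : P.Q p ≠ 0) {L : Jet →L[ℝ] ℝ} (hL : L (1, p.2.2, F p) = 0) :
    L (P.ρ (base p), P.φ (base p), P.φ₁ p) = 0 ↔
      L (0, 1, P.lam p + vfA F P.Q p / P.Q p) = 0 := by
  rw [prolongation_eq hJ hP hp hQ, map_add, map_smul, map_smul, hL]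
  simp [hQ]

variable {H₁ H₂ : Jet → ℝ} {Ω₁ Ω₂ : Set Cov} {v₁ v₂ : CovField} {z₁ z₂ : Plane → ℝ}
  {ζ₁ ζ₂ : Jet → ℝ} {G₁ G₂ : ℝ × ℝ → ℝ → ℝ} {P₁ P₂ : LambdaPair}

/-- A common first integral is annihilated by `A` and by both prolongations; in three dimensions
this forces the planes spanned by `A` and each of the prolongations to coincide. -/
theorem aEquivalent_of_functionallyDependent (hJ : IsOpen J)
    (hr₁ : IsReduction F J H₁ Ω₁ v₁ z₁ ζ₁ G₁) (hr₂ : IsReduction F J H₂ Ω₂ v₂ z₂ ζ₂ G₂)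
    (hP₁ : IsAdapted J z₁ ζ₁ P₁) (hP₂ : IsAdapted J z₂ ζ₂ P₂)
    (hs₁ : P₁.IsLambdaSymmetry F J) (hs₂ : P₂.IsLambdaSymmetry F J)
    (h : FunctionallyDependent J z₁ ζ₁ G₁ z₂ ζ₂ G₂) : AEquivalent F J P₁ P₂ := by
  intro p hp
  refine ⟨hP₁.Q_ne p hp, hP₂.Q_ne p hp, ?_⟩
  obtain ⟨U, hU, hpU, hUJ, V₁, V₂, I₁, I₂, hI₁, hI₂, S, g, hS, hg, hUg⟩ := h p hp
  obtain ⟨hV₁, hV₂, hpS, -⟩ := hUg p hpU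
  obtain ⟨hA, hY₁, hne⟩ := hI₁.fderiv_comp_newCoords hJ hr₁ hP₁ hp hV₁
  obtain ⟨-, hY₂, -⟩ := hI₂.fderiv_comp_newCoords hJ hr₂ hP₂ hp hV₂
  set f₁ : Jet → ℝ := fun p' => I₁ (newCoords z₁ ζ₁ p')
  set f₂ : Jet → ℝ := fun p' => I₂ (newCoords z₂ ζ₂ p') with hf₂
  have hd₂ : DifferentiableAt ℝ f₂ p :=
    (differentiableAt_of_contDiffOn hI₂.1 hI₂.2.1 hV₂).comp p
      (((contDiffOn_newCoords hr₂).contDiffAt (hJ.mem_nhds hp)).differentiableAt (by simp))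
  have hdg : HasDerivAt g (deriv g (f₂ p)) (f₂ p) :=
    (differentiableAt_of_contDiffOn hS hg hpS).hasDerivAt
  have hchain : fderiv ℝ f₁ p = deriv g (f₂ p) • fderiv ℝ f₂ p := by
    refine HasFDerivAt.fderiv ((hdg.comp_hasFDerivAt p hd₂.hasFDerivAt).congr_of_eventuallyEq ?_)
    filter_upwards [hU.mem_nhds hpU] with p' hp' using (hUg p' hp').2.2.2
  have hY₂' : fderiv ℝ f₁ p (P₂.ρ (base p), P₂.φ (base p), P₂.φ₁ p) = 0 := by
    rw [hchain, smul_apply, hY₂, smul_zero]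
  rw [map_prolongation_eq_zero_iff hJ hs₁ hp (hP₁.Q_ne p hp) hA, map_jet] at hY₁
  rw [map_prolongation_eq_zero_iff hJ hs₂ hp (hP₂.Q_ne p hp) hA, map_jet] at hY₂'
  by_contra hκ
  refine hne ?_
  have h1 : fderiv ℝ f₁ p (0, 0, 1) = 0 :=
    (mul_eq_zero.1 (by linear_combination hY₁ - hY₂' :
      (P₁.lam p + vfA F P₁.Q p / P₁.Q p - (P₂.lam p + vfA F P₂.Q p / P₂.Q p)) *
        fderiv ℝ f₁ p (0, 0, 1) = 0)).resolve_left (sub_ne_zero.2 hκ)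
  have h2 : fderiv ℝ f₁ p (0, 1, 0) = 0 := by
    rw [h1] at hY₁
    linear_combination hY₁
  have h3 : fderiv ℝ f₁ p (1, 0, 0) = 0 := by
    rw [map_jet, h1, h2] at hA
    linear_combination hA
  refine ContinuousLinearMap.ext fun ⟨a, b, c⟩ => ?_
  rw [map_jet, h1, h2, h3]
  simp

/-- A first integral of one reduced equation, as a function of `(t, x, x₁)`, is annihilated by `A`
and, by `A`-equivalence, by the other prolongation. So it is also a function of the other pair of
invariants, and a first integral of the other reduced equation. -/
theorem functionallyDependent_of_aEquivalent (hJ : IsOpen J) (hF : ContDiffOn ℝ ∞ F J)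
    (hr₁ : IsReduction F J H₁ Ω₁ v₁ z₁ ζ₁ G₁) (hr₂ : IsReduction F J H₂ Ω₂ v₂ z₂ ζ₂ G₂)
    (hP₁ : IsAdapted J z₁ ζ₁ P₁) (hP₂ : IsAdapted J z₂ ζ₂ P₂)
    (hs₁ : P₁.IsLambdaSymmetry F J) (hs₂ : P₂.IsLambdaSymmetry F J)
    (h : AEquivalent F J P₁ P₂) : FunctionallyDependent J z₁ ζ₁ G₁ z₂ ζ₂ G₂ := by
  intro p hp
  obtain ⟨V₁, I₁, hI₁, hpV₁⟩ := exists_isFirstIntegral hJ hF hr₁ hP₁ hp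
  have hU : IsOpen (J ∩ newCoords z₁ ζ₁ ⁻¹' V₁) :=
    (contDiffOn_newCoords hr₁).continuousOn.isOpen_inter_preimage hJ hI₁.1
  have hf : ContDiffOn ℝ ∞ (fun p' => I₁ (newCoords z₁ ζ₁ p')) (J ∩ newCoords z₁ ζ₁ ⁻¹' V₁) :=
    hI₁.2.1.comp ((contDiffOn_newCoords hr₁).mono Set.inter_subset_left) (fun x hx => hx.2)
  have hA := fun p' (hp' : p' ∈ J ∩ newCoords z₁ ζ₁ ⁻¹' V₁) =>
    hI₁.fderiv_comp_newCoords hJ hr₁ hP₁ hp'.1 hp'.2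
  have hker : ∀ p' ∈ J ∩ newCoords z₁ ζ₁ ⁻¹' V₁,
      fderiv ℝ (fun p' => I₁ (newCoords z₁ ζ₁ p')) p'
        (P₂.ρ (base p'), P₂.φ (base p'), P₂.φ₁ p') = 0 := by
    intro p' hp'
    obtain ⟨h1, h2, -⟩ := hA p' hp'
    rw [map_prolongation_eq_zero_iff hJ hs₁ hp'.1 (hP₁.Q_ne p' hp'.1) h1,
      (h p' hp'.1).2.2] at h2
    exact (map_prolongation_eq_zero_iff hJ hs₂ hp'.1 (hP₂.Q_ne p' hp'.1) h1).2 h2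
  obtain ⟨U', V₂, I₂, hU', hpU', hUU', hV₂, hUV, hI₂, hfI⟩ :=
    exists_factorization hJ hr₂ hP₂ hU Set.inter_subset_left hf hker ⟨hp, hpV₁⟩
  have hmaps : ∀ p' ∈ U', newCoords z₂ ζ₂ p' ∈ V₂ := fun p' hp' =>
    hUV ▸ Set.mem_image_of_mem _ hp'
  refine ⟨U', hU', hpU', hUU'.trans Set.inter_subset_left, V₁, V₂, I₁, I₂, hI₁,
    ⟨hV₂, hI₂, fun y hy => ?_⟩, Set.univ, id, isOpen_univ, contDiffOn_id, fun p' hp' =>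
      ⟨(hUU' hp').2, hmaps p' hp', Set.mem_univ _, hfI p' hp'⟩⟩
  obtain ⟨p', hp', rfl⟩ : y ∈ newCoords z₂ ζ₂ '' U' := hUV ▸ hy
  have hpJ : p' ∈ J := (hUU' hp').1
  obtain ⟨h1, -, h2⟩ := hA p' (hUU' hp')
  have heq : (fun p' => I₁ (newCoords z₁ ζ₁ p')) =ᶠ[nhds p']
      fun p' => I₂ (newCoords z₂ ζ₂ p') := by
    filter_upwards [hU'.mem_nhds hp'] with x hx using hfI x hx
  have hId := differentiableAt_of_contDiffOn hV₂ hI₂ hy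
  rw [heq.fderiv_eq] at h1 h2
  refine ⟨fun h0 => h2 ?_, fun s hs => ?_⟩
  · refine ContinuousLinearMap.ext fun ⟨a, b, c⟩ => ?_
    rw [fderiv_comp_newCoords hJ hr₂ hpJ hId, h0]
    simp
  · have hD : fderiv ℝ z₂ (base p') (1, p'.2.2) ≠ 0 := hr₂.totalD_ne p' hpJ
    rw [(reduced_eq_zero_iff hr₂ hP₂ hpJ s).1 hs]
    rw [fderiv_comp_newCoords hJ hr₂ hpJ hId] at h1
    unfold zetaDeriv totalD₁ totalD₀
    field_simp
    linear_combination h1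

end NonlocalReduction

open NonlocalReduction
theorem mainTheorem3 (J : Set Jet) (hJ : IsOpen J) (F : Jet → ℝ) (hF : ContDiffOn ℝ ∞ F J)
    (H₁ H₂ : Jet → ℝ) (Ω₁ Ω₂ : Set Cov) (v₁ v₂ : CovField)
    (hv₁ : IsCoveringSymmetry F J H₁ Ω₁ v₁) (hv₂ : IsCoveringSymmetry F J H₂ Ω₂ v₂)
    (z₁ z₂ : Plane → ℝ) (ζ₁ ζ₂ : Jet → ℝ) (G₁ G₂ : ℝ × ℝ → ℝ → ℝ)
    (hr₁ : IsReduction F J H₁ Ω₁ v₁ z₁ ζ₁ G₁) (hr₂ : IsReduction F J H₂ Ω₂ v₂ z₂ ζ₂ G₂)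
    (hc₁ : CaseOne Ω₁ v₁ ∨ CaseTwo Ω₁ v₁) (hc₂ : CaseOne Ω₂ v₂ ∨ CaseTwo Ω₂ v₂) :
    ∃ P₁ P₂ : LambdaPair,
      IsAssociatedPair F H₁ Ω₁ v₁ P₁ ∧ P₁.IsLambdaSymmetry F J ∧
      IsAssociatedPair F H₂ Ω₂ v₂ P₂ ∧ P₂.IsLambdaSymmetry F J ∧
      (FunctionallyDependent J z₁ ζ₁ G₁ z₂ ζ₂ G₂ ↔ AEquivalent F J P₁ P₂) := by
  obtain ⟨P₁, ha₁, hs₁, hP₁⟩ := exists_associatedPair hJ hv₁ hr₁ hc₁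
  obtain ⟨P₂, ha₂, hs₂, hP₂⟩ := exists_associatedPair hJ hv₂ hr₂ hc₂
  exact ⟨P₁, P₂, ha₁, hs₁, ha₂, hs₂,
    aEquivalent_of_functionallyDependent hJ hr₁ hr₂ hP₁ hP₂ hs₁ hs₂,
    functionallyDependent_of_aEquivalent hJ hF hr₁ hr₂ hP₁ hP₂ hs₁ hs₂⟩
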